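/- **Setting.** Let $n\ge 1$ and $V=\mathbb C^n$ with standard basis $e_1,\dots,e_n$. *Linear relations and hinges.* For a subspace $P\subset V\oplus V$ put $\operatorname{Ker}P=P\cap(V\oplus0)$, $\operatorname{Indef}P=P\cap(0\oplus V)$ (viewed in $V$), and let $\operatorname{Dom}P,\operatorname{Im}P\subset V$ be the projections of $P$ to the first and second summand. Let $\mathrm{Gr}_n$ be the Grassmannian of $n$-dimensional subspaces of $V\oplus V$. A hinge is a family $\mathcal P=(P_1,\dots,P_k)$, $k\ge1$, $P_j\in\mathrm{Gr}_n$, with $\operatorname{Ker}P_j=\operatorname{Dom}P_{j+1}$ and $\operatorname{Im}P_j=\operatorname{Indef}P_{j+1}$ for $1\le j<k$, $\operatorname{Dom}P_1=V$, $\operatorname{Im}P_k=V$, and $P_j\neq\operatorname{Ker}P_j\oplus\operatorname{Indef}P_j$ for all $j$. *The collection $\mathcal L(\mathcal P)$.* For an operator $A$ on $V$ let $\lambda^d_{\rm cha}(A)$ be the operator $v_1\wedge\dots\wedge v_d\mapsto Av_1\wedge\dots\wedge Av_d$ on $\Lambda^dV$. For $S\in\mathrm{Gr}_n$ choose bases $(u_i)$,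 $(w_i)$ of $V$ and $0\le p\le q\le n$ such that $S$ is spanned by $0\oplus w_i$ $(i\le p)$, $u_i\oplus w_i$ $(p<i\le q)$, $u_i\oplus 0$ $(i>q)$; the operator $\lambda(S)$ on $\Lambda V$, defined up to a nonzero factor, sends $u_{i_1}\wedge\dots\wedge u_{i_d}$ $(i_1<\dots<i_d)$ to $w_{i_1}\wedge\dots\wedge w_{i_d}$ if $\{1,\dots,p\}\subset\{i_1,\dots,i_d\}\subset\{1,\dots,q\}$ and to $0$ otherwise; $\lambda^d(S)$ is its restriction to $\Lambda^dV$. For a hinge $\mathcal P$ the factors are fixed by $\lambda(P_1)=\lambda_{\rm cha}(A)$, where $P_1$ is the graph of $A$, and $\lambda^{d}(P_j)=\lambda^{d}(P_{j+1})$ for $d=\dim\operatorname{Im}P_j$, $1\le j<k$. Then $\mathcal L^d(\mathcal P)$ is the unique nonzero operator among $\lambda^d(P_1),\dots,\lambda^d(P_k)$, and $\mathcal L(\mathcal P)=(\mathcal L^0(\mathcal P),\dots,\mathcal L^n(\mathcal P))$. *The representation $\rho_\nu$.* Let $\nu_1\ge\dots\ge\nu_n\ge0$ be integers, $\nu_{n+1}=0$.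 On $\mathfrak H_\nu=\bigotimes_{j=1}^n(\Lambda^jV)^{\otimes(\nu_j-\nu_{j+1})}$ a collection $\mathcal A=(A_0,\dots,A_n)$ of operators $A_j$ on $\Lambda^jV$ acts by $\mathfrak r_\nu(\mathcal A)=\bigotimes_{j=1}^n A_j^{\otimes(\nu_j-\nu_{j+1})}$, and $g\in GL_n(\mathbb C)$ acts by $\mathfrak r_\nu(g)=\mathfrak r_\nu(\lambda^0_{\rm cha}(g),\dots,\lambda^n_{\rm cha}(g))$. Let $H_\nu$ be the span of the $GL_n(\mathbb C)$-orbit of $\bigotimes_{j}(e_1\wedge\dots\wedge e_j)^{\otimes(\nu_j-\nu_{j+1})}$. Then $\rho_\nu(g)$ and $\rho_\nu(\mathcal A)$ denote the restrictions of $\mathfrak r_\nu(g)$ and $\mathfrak r_\nu(\mathcal A)$ to $H_\nu$, whenever $H_\nu$ is invariant. (The $\rho_\nu$ are the irreducible polynomial representations of $GL_n(\mathbb C)$.) *Meromorphic families.* A meromorphic family $\gamma$ is an $n\times n$ matrix of functions holomorphic in a punctured disk around $0$ with at most poles at $0$, such that $\gamma(z)$ is invertible for all small $z\ne0$. Integers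 $m_1\ge\dots\ge m_n$ are the exponents of $\gamma$ if $\gamma(z)=a(z)\operatorname{diag}(z^{-m_1},\dots,z^{-m_n})\,b(z)$ for small $z\neq 0$, where $a,b$ are matrices of functions holomorphic near $0$ with $a(0),b(0)$ invertible. Let $k_1>\dots>k_\tau$ be the distinct values of the exponents, and let $\mathcal P^\gamma=(P_1,\dots,P_\tau)$, $P_j=\lim_{z\to0}\operatorname{graph}(z^{k_j}\gamma(z))$ in $\mathrm{Gr}_n$. **Lemma 3.4.** Let $\gamma$ be a meromorphic family of $n\times n$ matrices and let $\nu_1\ge\dots\ge\nu_n\ge 0$ be integers. Then $\gamma$ has exponents, and for its exponents $m_i$: a) the limit $[\rho_\nu(\gamma)]:=\lim_{z\to0}z^{\sum_i m_i\nu_i}\rho_\nu(\gamma(z))$ exists in the space of operators on $H_\nu$ and is nonzero; b) the limits $P_j$ exist, $\mathcal P^\gamma$ is a hinge, $\mathcal L(\mathcal P^\gamma)$ is well defined, and $[\rho_\nu(\gamma)]=\rho_\nu(\mathcal L(\mathcal P^\gamma))$. -/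

import Mathlib

open Filter Topology

noncomputable section

namespace Urchin

/-- The space `V = ℂⁿ`. -/
abbrev V (n : ℕ) : Type := Fin n → ℂ

/-! ### Linear relations and the Grassmannian -/

/-- `Ker P = P ∩ (V ⊕ 0)`, as a subspace of `V`. -/
def relKer {n : ℕ} (P : Submodule ℂ (V n × V n)) : Submodule ℂ (V n) :=
  P.comap (LinearMap.inl ℂ (V n) (V n))

/-- `Indef P = P ∩ (0 ⊕ V)`, as a subspace of `V`. -/
def relIndef {n : ℕ} (P : Submodule ℂ (V n × V n)) : Submodule ℂ (V n) :=
  P.comap (LinearMap.inr ℂ (V n) (V n))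

/-- `Dom P`, the projection of `P` to the first summand. -/
def relDom {n : ℕ} (P : Submodule ℂ (V n × V n)) : Submodule ℂ (V n) :=
  P.map (LinearMap.fst ℂ (V n) (V n))

/-- `Im P`, the projection of `P` to the second summand. -/
def relIm {n : ℕ} (P : Submodule ℂ (V n × V n)) : Submodule ℂ (V n) :=
  P.map (LinearMap.snd ℂ (V n) (V n))

/-- The Grassmannian `Gr_n` of `n`-dimensional subspaces of `V ⊕ V`. -/
def Gr (n : ℕ) : Type :=
  {S : Submodule ℂ (V n × V n) // Module.finrank ℂ S = n}

/-- Linearly independent `n`-tuples of vectors of `V ⊕ V`. -/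
abbrev Frame (n : ℕ) : Type :=
  {x : Fin n → V n × V n // LinearIndependent ℂ x}

/-- The subspace spanned by a frame. -/
def Frame.toGr {n : ℕ} (x : Frame n) : Gr n :=
  ⟨Submodule.span ℂ (Set.range x.1), by
    simpa using finrank_span_eq_card x.2⟩

/-- The usual topology of the Grassmannian: the quotient topology from the space of frames. -/
instance (n : ℕ) : TopologicalSpace (Gr n) :=
  TopologicalSpace.coinduced Frame.toGr inferInstance

/-- The graph `{v ⊕ Av}` of a linear operator, as a point of the Grassmannian. -/
def graphGr {n : ℕ} (A : V n →ₗ[ℂ] V n) : Gr n :=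
  ⟨A.graph, by
    rw [LinearMap.graph_eq_range_prod, LinearMap.finrank_range_of_inj]
    · simp
    · intro v w h
      exact congrArg Prod.fst h⟩

/-! ### Hinges -/

/-- The finite family `(P₁, …, P_k)` of `n`-dimensional linear relations is a hinge. -/
structure IsHinge {n k : ℕ} (P : Fin k → Gr n) : Prop where
  pos : 0 < k
  ker_eq_dom : ∀ i j : Fin k, i.val + 1 = j.val → relKer (P i).1 = relDom (P j).1
  im_eq_indef : ∀ i j : Fin k, i.val + 1 = j.val → relIm (P i).1 = relIndef (P j).1
  dom_first : ∀ j : Fin k, j.val = 0 → relDom (P j).1 = ⊤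
  im_last : ∀ j : Fin k, j.val + 1 = k → relIm (P j).1 = ⊤
  ne_prod : ∀ j : Fin k, (P j).1 ≠ (relKer (P j).1).prod (relIndef (P j).1)

/-! ### Operators in the exterior powers -/

/-- Collections `(A₀, A₁, A₂, …)` of operators `A_d : Λ^d V → Λ^d V`. -/
abbrev ExtOps (n : ℕ) : Type := ∀ d : ℕ, Module.End ℂ (⋀[ℂ]^d (V n))

/-- The operators of change of variables
`v₁ ∧ ⋯ ∧ v_d ↦ A v₁ ∧ ⋯ ∧ A v_d` in the exterior powers. -/
def lamCha {n : ℕ} (A : V n →ₗ[ℂ] V n) : ExtOps n :=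
  fun d => exteriorPower.map d A

/-- `T` is one of the (mutually proportional) choices of the operator `λ(S)`, decomposed by
degree. Here `S` is an `n`-dimensional linear relation; `e` and `E` are bases of `V` such that `S`
is spanned by `0 ⊕ E_i` for `i < p`, `e_i ⊕ E_i` for `p ≤ i < q`, and `e_i ⊕ 0` for `q ≤ i`.
The operator `λ(S)` sends the wedge product of the `e_i`, `i ∈ I`, to the wedge product of the
`E_i`, `i ∈ I`, when `{i < p} ⊆ I ⊆ {i < q}`, and to `0` for all other `I`. (All finite sequences
`s` of indices are allowed below; the condition for a sequence with a repetition is void, both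
sides being zero, and for a permuted sequence both sides change by the same sign.) -/
def IsLambda {n : ℕ} (S : Gr n) (T : ExtOps n) : Prop :=
  ∃ (e E : Module.Basis (Fin n) ℂ (V n)) (p q : ℕ) (c : ℂ), p ≤ q ∧ q ≤ n ∧ c ≠ 0 ∧
    S.1 = Submodule.span ℂ (Set.range fun i : Fin n =>
      if i.val < p then ((0 : V n), E i) else if i.val < q then (e i, E i) else (e i, 0)) ∧
    ∀ (d : ℕ) (s : Fin d → Fin n),
      (((∀ i : Fin n, i.val < p → i ∈ Set.range s) ∧ (∀ j, (s j).val < q)) →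
        T d (exteriorPower.ιMulti ℂ d (e ∘ s)) = c • exteriorPower.ιMulti ℂ d (E ∘ s)) ∧
      (¬ ((∀ i : Fin n, i.val < p → i ∈ Set.range s) ∧ (∀ j, (s j).val < q)) →
        T d (exteriorPower.ιMulti ℂ d (e ∘ s)) = 0)

/-- `L = 𝓛(P)`, the canonical collection of operators of a hinge `P = (P₁, …, P_k)`.
Representatives `T_j` of the `λ(P_j)` are normalized by `λ(P₁) = λ_cha(A)`, where `P₁` is the graph
of `A`, and by the gluing conditions `λ^d(P_j) = λ^d(P_{j+1})` for `d = dim Im P_j`; then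
`𝓛^d(P)` is the unique nonzero operator among `λ^d(P₁), …, λ^d(P_k)`, for `d = 0, …, n`.
(For `d > n` the space `Λ^d V` is zero.) -/
def IsCanonicalCollection {n k : ℕ} (P : Fin k → Gr n) (L : ExtOps n) : Prop :=
  ∃ T : Fin k → ExtOps n,
    (∀ j, IsLambda (P j) (T j)) ∧
    (∀ j : Fin k, j.val = 0 → ∀ A : V n →ₗ[ℂ] V n, P j = graphGr A → T j = lamCha A) ∧
    (∀ i j : Fin k, i.val + 1 = j.val →
      T i (Module.finrank ℂ (relIm (P i).1)) = T j (Module.finrank ℂ (relIm (P i).1))) ∧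
    ∀ d ≤ n, ∃ j, T j d ≠ 0 ∧ L d = T j d

/-! ### The representations `ρ_ν` -/

/-- `ν_j - ν_{j+1}`, with the convention `ν_{n+1} = 0`. -/
def drop {n : ℕ} (ν : Fin n → ℕ) (j : Fin n) : ℕ :=
  ν j - (if h : j.val + 1 < n then ν ⟨j.val + 1, h⟩ else 0)

/-- The tensor factors of `𝔥_ν`: the `j`-th exterior power occurs `ν_j - ν_{j+1}` times. -/
abbrev Factors {n : ℕ} (ν : Fin n → ℕ) : Type := Σ j : Fin n, Fin (drop ν j)

/-- `𝔥_ν = ⨂_{j=1}^n (Λ^j V)^{⊗(ν_j - ν_{j+1})}`. (The indices of `Fin n` start with `0`.) -/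
abbrev BigH {n : ℕ} (ν : Fin n → ℕ) : Type :=
  PiTensorProduct ℂ (fun x : Factors ν => ⋀[ℂ]^(x.1.val + 1) (V n))

/-- `𝔯_ν(A) = ⨂_{j=1}^n A_j^{⊗(ν_j - ν_{j+1})}`. -/
def bigRho {n : ℕ} (ν : Fin n → ℕ) (A : ExtOps n) : Module.End ℂ (BigH ν) :=
  PiTensorProduct.map (fun x : Factors ν => A (x.1.val + 1))

/-- `ξ_d = e₁ ∧ ⋯ ∧ e_d` for `d ≤ n`. -/
def xi {n : ℕ} (d : ℕ) (hd : d ≤ n) : ⋀[ℂ]^d (V n) :=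
  exteriorPower.ιMulti ℂ d (fun i : Fin d => (Pi.single (Fin.castLE hd i) 1 : V n))

/-- `Ξ_ν = ⨂_{j=1}^n ξ_j^{⊗(ν_j - ν_{j+1})}`. -/
def bigXi {n : ℕ} (ν : Fin n → ℕ) : BigH ν :=
  PiTensorProduct.tprod ℂ (fun x : Factors ν => xi (x.1.val + 1) x.1.isLt)

/-- `H_ν`, the `GL_n(ℂ)`-cyclic span of `Ξ_ν`. -/
def H {n : ℕ} (ν : Fin n → ℕ) : Submodule ℂ (BigH ν) :=
  Submodule.span ℂ (Set.range fun g : V n ≃ₗ[ℂ] V n =>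
    bigRho ν (lamCha (g : V n →ₗ[ℂ] V n)) (bigXi ν))

open Classical in
/-- `ρ_ν(A)`, the restriction of `𝔯_ν(A)` to the subspace `H_ν` (and, by convention, `0` for those
collections `A` for which `H_ν` is not invariant). The representation `ρ_ν` of `GL_n(ℂ)` is
`g ↦ ρ_ν(λ_cha(g))`. -/
def rho {n : ℕ} (ν : Fin n → ℕ) (A : ExtOps n) : Module.End ℂ (H ν) :=
  if h : ∀ x ∈ H ν, bigRho ν A x ∈ H ν then (bigRho ν A).restrict h else 0

/-! ### Meromorphic families -/

/-- (The germ at `0` of) a meromorphic family `γ` of invertible matrices: the matrix elements are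
holomorphic in a punctured disk with at most a pole at `0`, and `γ(z)` is invertible in a punctured
disk. -/
def IsMeromorphicFamily {n : ℕ} (γ : ℂ → Matrix (Fin n) (Fin n) ℂ) : Prop :=
  (∀ i j, MeromorphicAt (fun z => γ z i j) 0) ∧ ∀ᶠ z in 𝓝[≠] (0 : ℂ), IsUnit (γ z)

/-- `a ∈ GL_n(𝓕)`: a germ at `0` of a holomorphic map to `GL_n(ℂ)`. -/
def IsHolomorphicGL {n : ℕ} (a : ℂ → Matrix (Fin n) (Fin n) ℂ) : Prop :=
  (∀ i j, AnalyticAt ℂ (fun z => a z i j) 0) ∧ IsUnit (a 0)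

/-- `m₁ ≥ ⋯ ≥ m_n` are the exponents of the family `γ`:
`γ(z) = a(z) diag(z^{-m₁}, …, z^{-m_n}) b(z)` with `a, b ∈ GL_n(𝓕)`. -/
def IsExponents {n : ℕ} (γ : ℂ → Matrix (Fin n) (Fin n) ℂ) (m : Fin n → ℤ) : Prop :=
  Antitone m ∧ ∃ a b : ℂ → Matrix (Fin n) (Fin n) ℂ, IsHolomorphicGL a ∧ IsHolomorphicGL b ∧
    ∀ᶠ z in 𝓝[≠] (0 : ℂ), γ z = a z * Matrix.diagonal (fun i => z ^ (-m i)) * b z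

/-- The number `τ` of pairwise different exponents. -/
def numExp {n : ℕ} (m : Fin n → ℤ) : ℕ := (Finset.univ.image m).card

/-- The pairwise different exponents in decreasing order, `k₁ > k₂ > ⋯ > k_τ`. -/
def distinctExp {n : ℕ} (m : Fin n → ℤ) (j : Fin (numExp m)) : ℤ :=
  (Finset.univ.image m).orderEmbOfFin rfl j.rev

/-- `P = 𝒫^γ = (P₁, …, P_τ)`, where `P_j = lim_{z → 0} z^{k_j} graph(γ(z))` in `Gr_n`. -/
def IsLimitFamily {n : ℕ} (γ : ℂ → Matrix (Fin n) (Fin n) ℂ) (m : Fin n → ℤ)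
    (P : Fin (numExp m) → Gr n) : Prop :=
  ∀ j, Tendsto (fun z : ℂ => graphGr (z ^ distinctExp m j • (γ z).toLin')) (𝓝[≠] 0) (𝓝 (P j))

/-- Convergence `T(z) → T₀` as `z → 0`, `z ≠ 0`, of operators in `H_ν`, with respect to the canonical
topology of the finite-dimensional complex vector space of these operators. -/
def OpTendsto {n : ℕ} (ν : Fin n → ℕ) (T : ℂ → Module.End ℂ (H ν)) (T₀ : Module.End ℂ (H ν)) :
    Prop :=
  Tendsto T (𝓝[≠] 0) (@nhds (Module.End ℂ (H ν)) (moduleTopology ℂ (Module.End ℂ (H ν))) T₀)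

end Urchin

end

/-! The germs of meromorphic functions at `0` have a discrete valuation, so γ can be brought to
Smith form γ = a · diag(z^{-m_i}) · b by elimination with a pivot of least order
(`exists_hasDiagonalForm`). Let `e` be the columns of b(0)⁻¹ and `E` the columns of a(0). In these
two bases both sides of the asserted equality become diagonal.

Hinge side: graph(z^k γ) has a frame of vectors proportional to z^{m_i-k} b⁻¹_i ⊕ a_i. When these
are rescaled to remove poles, the limit is the standard relation `stdRel e E p q`, where p counts
the exponents > k and q those ≥ k (`tendsto_graph`). For consecutive values of k the intervals [p,
q] fit end to end and cover [0, n], which gives the hinge axioms (`IsAdapted.isHinge`). An operator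
λ(S) satisfies T(v ∧ ω) = w ∧ Tω for v ⊕ w in S, and this determines it up to a factor
(`IsLambda.unique`). The normalizations then fix every factor, and 𝓛^d is the explicit 0-1 operator
e_I ↦ E_I for {i < p} ⊆ I ⊆ {i < q}, with p ≤ d ≤ q (`IsAdapted.canonical_eq`).

Representation side: Λ^d of the diagonal factor multiplies e_I by z^{-∑_I m_i}. Multiplying by z to
the sum of the d largest exponents leaves in the limit exactly the sets I of maximal sum
(`finTendsto_smul_lamCha`), and for p ≤ d ≤ q these are the sets above (`lamWeight_eq_maxWeight`).
Tensoring these limits produces the power ∑ m_i ν_i by Abel summation (`sum_factors_topSum`). The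
limit preserves H_ν because subspaces are closed, and it is nonzero because it does not kill the
vector b(0)⁻¹ Ξ_ν of H_ν. -/

noncomputable section

namespace Urchin


/-! ### Coordinates in exterior powers -/

section Exterior

variable {n d : ℕ}

/-- Two injective sequences with the same set of values differ by a permutation. -/
theorem exists_perm_of_range_eq {α : Type*} {s t : Fin d → α} (hs : Function.Injective s)
    (ht : Function.Injective t) (h : Set.range s = Set.range t) :
    ∃ σ : Equiv.Perm (Fin d), s = t ∘ σ := by
  refine ⟨(Equiv.ofInjective s hs).trans
    ((Equiv.setCongr h).trans (Equiv.ofInjective t ht).symm), ?_⟩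
  funext i
  simp only [Function.comp_apply, Equiv.trans_apply]
  exact (Equiv.apply_ofInjective_symm ht (Equiv.setCongr h (Equiv.ofInjective s hs i))).symm

/-- The values of an injective sequence, as a subset of the given cardinality. -/
def valueSet (s : Fin d → Fin n) (hs : Function.Injective s) : Set.powersetCard (Fin n) d :=
  ⟨Finset.univ.image s, by
    rw [Set.powersetCard.mem_iff, Finset.card_image_of_injective _ hs]; simp⟩

theorem exists_perm_valueSet (s : Fin d → Fin n) (hs : Function.Injective s) :
    ∃ σ : Equiv.Perm (Fin d),
      s = (Set.powersetCard.ofFinEmbEquiv.symm (valueSet s hs) : Fin d → Fin n) ∘ σ := by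
  refine exists_perm_of_range_eq hs
    (Set.powersetCard.ofFinEmbEquiv.symm (valueSet s hs)).injective ?_
  ext i
  rw [Set.powersetCard.mem_range_ofFinEmbEquiv_symm_iff_mem, ← Set.powersetCard.mem_coe_iff]
  simp [valueSet]

theorem ιMulti_comp_of_not_injective (e : Fin n → V n) {s : Fin d → Fin n}
    (hs : ¬ Function.Injective s) : exteriorPower.ιMulti ℂ d (e ∘ s) = 0 :=
  (exteriorPower.ιMulti ℂ d).map_eq_zero_of_not_injective _ fun h => hs h.of_comp

/-- The permutation sorts `s` and does not depend on the family. The same sign therefore appears for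
`e` and for `E`, and cancels when operators e_I ↦ E_I are evaluated on unsorted sequences. -/
theorem ιMulti_comp_eq_sign_smul (s : Fin d → Fin n)
    (hs : Function.Injective s) :
    ∃ σ : Equiv.Perm (Fin d), ∀ E : Fin n → V n, exteriorPower.ιMulti ℂ d (E ∘ s) =
      Equiv.Perm.sign σ • exteriorPower.ιMulti_family ℂ d E (valueSet s hs) := by
  obtain ⟨σ, hσ⟩ := exists_perm_valueSet s hs
  refine ⟨σ, fun E => ?_⟩
  rw [exteriorPower.ιMulti_family, ← AlternatingMap.map_perm]
  conv_lhs => rw [hσ]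
  rfl

theorem image_ofFinEmbEquiv_symm (t : Set.powersetCard (Fin n) d) :
    Finset.univ.image (Set.powersetCard.ofFinEmbEquiv.symm t : Fin d → Fin n) = t.1 := by
  ext i
  have := Set.powersetCard.mem_range_ofFinEmbEquiv_symm_iff_mem t i
  rw [← Set.powersetCard.mem_coe_iff] at this
  simpa using this

/-- Linear maps on an exterior power agree if they agree on the products of basis vectors. -/
theorem exterior_ext {W : Type*} [AddCommGroup W] [Module ℂ W]
    (e : Module.Basis (Fin n) ℂ (V n)) {f g : ⋀[ℂ]^d (V n) →ₗ[ℂ] W}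
    (h : ∀ s : Fin d → Fin n, f (exteriorPower.ιMulti ℂ d (e ∘ s)) =
      g (exteriorPower.ιMulti ℂ d (e ∘ s))) : f = g := by
  refine (e.exteriorPower d).ext fun t => ?_
  rw [exteriorPower.basis_apply]
  exact h _

/-- The operator `e_s ↦ φ(s) E_s`, where `s` runs over sequences of indices and `φ` depends on the
set of values of `s`. -/
def coordOp (e E : Module.Basis (Fin n) ℂ (V n)) (φ : Finset (Fin n) → ℂ) : ExtOps n :=
  fun d => (e.exteriorPower d).constr ℂ fun t => φ t.1 • exteriorPower.ιMulti_family ℂ d E t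

theorem coordOp_ιMulti (e E : Module.Basis (Fin n) ℂ (V n)) (φ : Finset (Fin n) → ℂ)
    (s : Fin d → Fin n) :
    coordOp e E φ d (exteriorPower.ιMulti ℂ d (e ∘ s)) =
      φ (Finset.univ.image s) • exteriorPower.ιMulti ℂ d (E ∘ s) := by
  by_cases hs : Function.Injective s
  · obtain ⟨σ, h⟩ := ιMulti_comp_eq_sign_smul s hs
    rw [h e, h E, ← exteriorPower.basis_apply, Units.smul_def, map_zsmul, coordOp,
      Module.Basis.constr_basis, smul_comm, Units.smul_def]
    rfl
  · rw [ιMulti_comp_of_not_injective _ hs, ιMulti_comp_of_not_injective _ hs]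
    simp

theorem ιMulti_comp_ne_zero (E : Module.Basis (Fin n) ℂ (V n)) {s : Fin d → Fin n}
    (hs : Function.Injective s) : exteriorPower.ιMulti ℂ d (E ∘ s) ≠ 0 := by
  obtain ⟨σ, h⟩ := ιMulti_comp_eq_sign_smul s hs
  rw [h E, smul_ne_zero_iff_ne, ← exteriorPower.basis_apply]
  exact (E.exteriorPower d).ne_zero _

theorem repr_ιMulti_of_ne (E : Module.Basis (Fin n) ℂ (V n)) {s : Fin d → Fin n}
    {u : Set.powersetCard (Fin n) d} (h : Finset.univ.image s ≠ u.1) :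
    (E.exteriorPower d).coord u (exteriorPower.ιMulti ℂ d (E ∘ s)) = 0 := by
  by_cases hs : Function.Injective s
  · obtain ⟨σ, hσ⟩ := ιMulti_comp_eq_sign_smul s hs
    rw [hσ E, Units.smul_def, map_zsmul, Module.Basis.coord_apply,
      exteriorPower.basis_repr_ne, smul_zero]
    intro h'
    exact h (congrArg Subtype.val h')
  · rw [ιMulti_comp_of_not_injective _ hs, map_zero]

theorem repr_ιMulti_ne_zero (E : Module.Basis (Fin n) ℂ (V n)) {s : Fin d → Fin n}
    (hs : Function.Injective s) {u : Set.powersetCard (Fin n) d}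
    (h : Finset.univ.image s = u.1) :
    (E.exteriorPower d).coord u (exteriorPower.ιMulti ℂ d (E ∘ s)) ≠ 0 := by
  obtain ⟨σ, hσ⟩ := ιMulti_comp_eq_sign_smul s hs
  have : valueSet s hs = u := Subtype.ext h
  rw [hσ E, Units.smul_def, map_zsmul, Module.Basis.coord_apply, this,
      exteriorPower.basis_repr_self]
  rcases Int.units_eq_one_or (Equiv.Perm.sign σ) with h | h <;> simp [h]

/-- Left multiplication by a vector. -/
def wedgeL (d : ℕ) (v : V n) : ⋀[ℂ]^d (V n) →ₗ[ℂ] ⋀[ℂ]^(d + 1) (V n) :=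
  ((LinearMap.mulLeft ℂ (ExteriorAlgebra.ι ℂ v)).comp (Submodule.subtype _)).codRestrict _
    fun x => by
      change ExteriorAlgebra.ι ℂ v * x.1 ∈ (LinearMap.range (ExteriorAlgebra.ι ℂ)) ^ (d + 1)
      rw [pow_succ']
      exact Submodule.mul_mem_mul (LinearMap.mem_range_self _ _) x.2

theorem wedgeL_coe (v : V n) (x : ⋀[ℂ]^d (V n)) :
    (wedgeL d v x : ExteriorAlgebra ℂ (V n)) = ExteriorAlgebra.ι ℂ v * x := rfl

theorem wedgeL_add (v w : V n) : wedgeL d (v + w) = wedgeL d v + wedgeL d w := by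
  ext x
  simp [wedgeL_coe, add_mul]

theorem wedgeL_smul (c : ℂ) (v : V n) : wedgeL d (c • v) = c • wedgeL d v := by
  ext x
  simp [wedgeL_coe]

theorem wedgeL_zero : wedgeL d (0 : V n) = 0 := by
  simpa using wedgeL_smul (d := d) 0 (0 : V n)

theorem ιMulti_succ (u : Fin (d + 1) → V n) :
    exteriorPower.ιMulti ℂ (d + 1) u =
      wedgeL d (u 0) (exteriorPower.ιMulti ℂ d (Fin.tail u)) := by
  apply Subtype.ext
  rw [wedgeL_coe]
  simp only [exteriorPower.ιMulti_apply_coe]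
  exact ExteriorAlgebra.ιMulti_succ_apply u

theorem wedgeL_ιMulti_comp (e : Fin n → V n) (i : Fin n) (s : Fin d → Fin n) :
    wedgeL d (e i) (exteriorPower.ιMulti ℂ d (e ∘ s)) =
      exteriorPower.ιMulti ℂ (d + 1) (e ∘ (Fin.cons i s : Fin (d + 1) → Fin n)) := by
  rw [ιMulti_succ]
  rfl

theorem wedgeL_ιMulti_comp_of_mem (e : Fin n → V n) {i : Fin n} {s : Fin d → Fin n}
    (h : i ∈ Set.range s) : wedgeL d (e i) (exteriorPower.ιMulti ℂ d (e ∘ s)) = 0 := by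
  rw [wedgeL_ιMulti_comp]
  obtain ⟨j, rfl⟩ := h
  refine ιMulti_comp_of_not_injective _ fun hinj => ?_
  exact Fin.succ_ne_zero j (hinj (by simp))

theorem image_cons (i : Fin n) (s : Fin d → Fin n) :
    Finset.univ.image (Fin.cons i s : Fin (d + 1) → Fin n) =
      insert i (Finset.univ.image s) := by
  ext j
  simp [Fin.exists_fin_succ, eq_comm]

/-- Multiplication by E_i kills E_t for i ∈ t and sends the other E_t, up to sign, to the distinct
basis vectors E_{t ∪ i}. Hence the coefficient of x at t reappears in E_i ∧ x at t ∪ {i}. -/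
theorem coord_eq_zero_of_wedgeL_eq_zero (E : Module.Basis (Fin n) ℂ (V n)) {i : Fin n}
    {x : ⋀[ℂ]^d (V n)} (hx : wedgeL d (E i) x = 0) (t : Set.powersetCard (Fin n) d)
    (hi : i ∉ t.1) : (E.exteriorPower d).repr x t = 0 := by
  have htc : t.1.card = d := t.2
  let u : Set.powersetCard (Fin n) (d + 1) :=
    ⟨insert i t.1, by rw [Set.powersetCard.mem_iff, Finset.card_insert_of_notMem hi, htc]⟩
  have hsum : (E.exteriorPower (d + 1)).coord u (wedgeL d (E i) x) =
      ∑ t' : Set.powersetCard (Fin n) d, (E.exteriorPower d).repr x t' *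
        (E.exteriorPower (d + 1)).coord u (wedgeL d (E i) (E.exteriorPower d t')) := by
    conv_lhs => rw [← (E.exteriorPower d).sum_repr x]
    simp only [map_sum, map_smul, smul_eq_mul]
  rw [hx, map_zero, Finset.sum_eq_single t] at hsum
  · refine (mul_eq_zero.1 hsum.symm).resolve_right ?_
    rw [exteriorPower.basis_apply, exteriorPower.ιMulti_family, wedgeL_ιMulti_comp]
    refine repr_ιMulti_ne_zero E ?_ ?_
    · rw [Fin.cons_injective_iff]
      refine ⟨?_, (Set.powersetCard.ofFinEmbEquiv.symm t).injective⟩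
      rwa [Set.powersetCard.mem_range_ofFinEmbEquiv_symm_iff_mem, ← Set.powersetCard.mem_coe_iff]
    · rw [image_cons, image_ofFinEmbEquiv_symm]
  · intro t' _ hne
    rw [exteriorPower.basis_apply, exteriorPower.ιMulti_family]
    by_cases hit : i ∈ t'.1
    · rw [wedgeL_ιMulti_comp_of_mem, map_zero, mul_zero]
      rwa [Set.powersetCard.mem_range_ofFinEmbEquiv_symm_iff_mem, ← Set.powersetCard.mem_coe_iff]
    · rw [wedgeL_ιMulti_comp, repr_ιMulti_of_ne, mul_zero]
      rw [image_cons, image_ofFinEmbEquiv_symm]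
      intro h
      apply hne
      apply Subtype.ext
      have h' : insert i t'.1 = insert i t.1 := h
      rw [← Finset.erase_insert hit, h', Finset.erase_insert hi]
  · simp

/-- Only sets t containing all i < p can contribute to x, and a set of d < p elements cannot. In
degree p, treated next, exactly one set remains. -/
theorem eq_zero_of_wedgeL_eq_zero (E : Module.Basis (Fin n) ℂ (V n)) {p : ℕ} (hp : p ≤ n)
    (hd : d < p) {x : ⋀[ℂ]^d (V n)} (hx : ∀ i : Fin n, i.val < p → wedgeL d (E i) x = 0) :
    x = 0 := by
  refine (E.exteriorPower d).ext_elem fun t => ?_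
  have htc : t.1.card = d := t.2
  obtain ⟨i, hi, hit⟩ : ∃ i ∈ Finset.univ.image (Fin.castLE hp), i ∉ t.1 := by
    apply Finset.exists_mem_notMem_of_card_lt_card
    rw [Finset.card_image_of_injective _ (Fin.castLE_injective hp), htc]
    simpa using hd
  obtain ⟨j, -, rfl⟩ := Finset.mem_image.1 hi
  rw [coord_eq_zero_of_wedgeL_eq_zero E (hx _ (by simp)) t hit]
  simp

theorem eq_smul_of_wedgeL_eq_zero (E : Module.Basis (Fin n) ℂ (V n)) {p : ℕ} (hp : p ≤ n)
    {x : ⋀[ℂ]^p (V n)} (hx : ∀ i : Fin n, i.val < p → wedgeL p (E i) x = 0) :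
    ∃ c : ℂ, x = c • exteriorPower.ιMulti ℂ p (E ∘ Fin.castLE hp) := by
  obtain ⟨σ, hσ⟩ := ιMulti_comp_eq_sign_smul (Fin.castLE hp) (Fin.castLE_injective hp)
  set u := valueSet (Fin.castLE hp) (Fin.castLE_injective hp) with hu
  have huc : u.1.card = p := u.2
  have hx' : x = (E.exteriorPower p).repr x u • E.exteriorPower p u := by
    conv_lhs => rw [← (E.exteriorPower p).sum_repr x]
    refine Finset.sum_eq_single u (fun t _ hne => ?_) (by simp)
    have htc : t.1.card = p := t.2
    obtain ⟨i, hi, hit⟩ : ∃ i ∈ u.1, i ∉ t.1 := by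
      by_contra! hcon
      exact hne (Subtype.ext (Finset.eq_of_subset_of_card_le hcon (by omega)).symm)
    obtain ⟨j, -, rfl⟩ := Finset.mem_image.1 hi
    rw [coord_eq_zero_of_wedgeL_eq_zero E (hx _ (by simp)) t hit, zero_smul]
  rw [hσ E, ← exteriorPower.basis_apply]
  refine ⟨(E.exteriorPower p).repr x u * ((Equiv.Perm.sign σ : ℤ) : ℂ), ?_⟩
  conv_lhs => rw [hx']
  rcases Int.units_eq_one_or (Equiv.Perm.sign σ) with h | h <;> simp [h]

end Exterior


/-! ### The operator of a linear relation is determined up to a factor -/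

section Lambda

variable {n : ℕ}

/-- The span of `0 ⊕ E_i` for `i < p`, `e_i ⊕ E_i` for `p ≤ i < q`, and `e_i ⊕ 0` for `q ≤ i`. -/
def stdRel (e E : Module.Basis (Fin n) ℂ (V n)) (p q : ℕ) : Submodule ℂ (V n × V n) :=
  Submodule.span ℂ (Set.range fun i : Fin n =>
    if i.val < p then ((0 : V n), E i) else if i.val < q then (e i, E i) else (e i, 0))

/-- `T (v ∧ ω) = w ∧ T ω` for all `v ⊕ w` in `S`. -/
def Intertwines (S : Submodule ℂ (V n × V n)) (T : ExtOps n) : Prop :=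
  ∀ x ∈ S, ∀ (d : ℕ) (ω : ⋀[ℂ]^d (V n)),
    T (d + 1) (wedgeL d x.1 ω) = wedgeL d x.2 (T d ω)

/-- The set of the values of `s` contains all `i < p`, and lies in `{i < q}`. -/
def Admissible {d : ℕ} (p q : ℕ) (s : Fin d → Fin n) : Prop :=
  (∀ i : Fin n, i.val < p → i ∈ Set.range s) ∧ ∀ j, (s j).val < q

theorem admissible_cons {d p q : ℕ} {i : Fin n} (hp : p ≤ i.val) (hq : i.val < q)
    (s : Fin d → Fin n) :
    Admissible p q (Fin.cons i s : Fin (d + 1) → Fin n) ↔ Admissible p q s := by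
  constructor
  · rintro ⟨h1, h2⟩
    refine ⟨fun k hk => ?_, fun j => by simpa using h2 j.succ⟩
    obtain ⟨j, hj⟩ := h1 k hk
    refine j.cases (motive := fun j => (Fin.cons i s : Fin (d + 1) → Fin n) j = k → _)
      (fun h => ?_) (fun j h => ⟨j, by simpa using h⟩) hj
    simp only [Fin.cons_zero] at h
    omega
  · rintro ⟨h1, h2⟩
    refine ⟨fun k hk => ?_, fun j => ?_⟩
    · obtain ⟨j, hj⟩ := h1 k hk
      exact ⟨j.succ, by simpa using hj⟩
    · refine j.cases ?_ (fun j => ?_)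
      · simpa using hq
      · simpa using h2 j

theorem not_admissible_cons {d p q : ℕ} {i : Fin n} (hq : q ≤ i.val) (s : Fin d → Fin n) :
    ¬ Admissible p q (Fin.cons i s : Fin (d + 1) → Fin n) := by
  rintro ⟨-, h⟩
  have := h 0
  simp only [Fin.cons_zero] at this
  omega

/-- The relation is linear in v ⊕ w, so the spanning vectors suffice. For 0 ⊕ E_i the factor E_i
already occurs in every value of T; adjoining an index in [p, q) does not change admissibility;
adjoining an index ≥ q destroys it. -/
theorem IsLambda.intertwines {S : Gr n} {T : ExtOps n} (h : IsLambda S T) :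
    Intertwines S.1 T := by
  obtain ⟨e, E, p, q, c, hpq, hqn, hc, hS, hT⟩ := h
  have hT1 : ∀ {d : ℕ} {s : Fin d → Fin n}, Admissible p q s →
      T d (exteriorPower.ιMulti ℂ d (e ∘ s)) = c • exteriorPower.ιMulti ℂ d (E ∘ s) :=
    fun hs => (hT _ _).1 hs
  have hT2 : ∀ {d : ℕ} {s : Fin d → Fin n}, ¬ Admissible p q s →
      T d (exteriorPower.ιMulti ℂ d (e ∘ s)) = 0 := fun hs => (hT _ _).2 hs
  intro x hx
  rw [hS] at hx
  induction hx using Submodule.span_induction with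
  | mem x hx =>
    obtain ⟨i, rfl⟩ := hx
    intro d
    have key : ∀ (v w : V n), (∀ s : Fin d → Fin n,
        T (d + 1) (wedgeL d v (exteriorPower.ιMulti ℂ d (e ∘ s))) =
          wedgeL d w (T d (exteriorPower.ιMulti ℂ d (e ∘ s)))) →
        ∀ ω, T (d + 1) (wedgeL d v ω) = wedgeL d w (T d ω) := by
      intro v w h ω
      have := exterior_ext e (f := T (d + 1) ∘ₗ wedgeL d v) (g := wedgeL d w ∘ₗ T d) h
      exact LinearMap.congr_fun this ω
    apply key
    intro s
    dsimp only
    split_ifs with h1 h2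
    · rw [wedgeL_zero, LinearMap.zero_apply, map_zero]
      by_cases hs : Admissible p q s
      · rw [hT1 hs, map_smul, wedgeL_ιMulti_comp_of_mem _ (hs.1 i h1), smul_zero]
      · rw [hT2 hs, map_zero]
    · rw [wedgeL_ιMulti_comp]
      by_cases hs : Admissible p q s
      · rw [hT1 hs, map_smul, wedgeL_ιMulti_comp,
          hT1 ((admissible_cons (not_lt.1 h1) h2 s).2 hs)]
      · rw [hT2 hs, map_zero, hT2 (fun h => hs ((admissible_cons (not_lt.1 h1) h2 s).1 h))]
    · rw [wedgeL_ιMulti_comp, hT2 (not_admissible_cons (not_lt.1 h2) s), wedgeL_zero,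
        LinearMap.zero_apply]
  | zero => simp [wedgeL_zero]
  | add x y _ _ hx hy =>
    intro d ω
    simp [wedgeL_add, hx, hy]
  | smul a x _ hx =>
    intro d ω
    simp [wedgeL_smul, hx]

/-- The intertwining relation leaves one free constant, the value on e_1 ∧ ⋯ ∧ e_p. All other values
follow by induction on the degree. This makes the choice of bases in `IsLambda` immaterial. -/
theorem IsLambda.unique {S : Gr n} {T T' : ExtOps n} (h : IsLambda S T) (h' : IsLambda S T') :
    ∃ k : ℂ, ∀ d, T' d = k • T d := by
  have hI := h.intertwines
  have hI' := h'.intertwines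
  obtain ⟨e, E, p, q, c, hpq, hqn, hc, hS, hT⟩ := h
  have hpn : p ≤ n := hpq.trans hqn
  have hmem1 : ∀ i : Fin n, i.val < p → ((0 : V n), E i) ∈ S.1 := by
    intro i hi
    rw [hS]
    exact Submodule.subset_span ⟨i, by simp [hi]⟩
  have hmem2 : ∀ i : Fin n, p ≤ i.val → ∃ w, (e i, w) ∈ S.1 := by
    intro i hi
    rw [hS]
    by_cases hq : i.val < q
    · exact ⟨E i, Submodule.subset_span ⟨i, by simp [hi, hq]⟩⟩
    · exact ⟨0, Submodule.subset_span ⟨i, by simp [hi, hq]⟩⟩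
  have hkill : ∀ {T : ExtOps n}, Intertwines S.1 T → ∀ (d : ℕ) (ω : ⋀[ℂ]^d (V n)) (i : Fin n),
      i.val < p → wedgeL d (E i) (T d ω) = 0 := by
    intro T hT d ω i hi
    have := hT _ (hmem1 i hi) d ω
    rw [← this]
    simp [wedgeL_zero]
  -- In degree p every value of T' is annihilated by all E_i with i < p, so it lies on the line of
  -- E_1 ∧ ⋯ ∧ E_p.
  obtain ⟨c', hc'⟩ := eq_smul_of_wedgeL_eq_zero E hpn
    (hkill hI' p (exteriorPower.ιMulti ℂ p (e ∘ Fin.castLE hpn)))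
  have hadm : T p (exteriorPower.ιMulti ℂ p (e ∘ Fin.castLE hpn)) =
      c • exteriorPower.ιMulti ℂ p (E ∘ Fin.castLE hpn) :=
    (hT p _).1 ⟨fun i hi => ⟨⟨i, hi⟩, rfl⟩, fun j => by
      have := j.2
      simp only [Fin.val_castLE]
      omega⟩
  have hp0 : T' p (exteriorPower.ιMulti ℂ p (e ∘ Fin.castLE hpn)) =
      (c' / c) • T p (exteriorPower.ιMulti ℂ p (e ∘ Fin.castLE hpn)) := by
    rw [hc', hadm, smul_smul, div_mul_cancel₀ _ hc]
  refine ⟨c' / c, fun d => exterior_ext e ?_⟩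
  induction d with
  | zero =>
    intro s
    rcases Nat.eq_zero_or_pos p with rfl | hp
    · have : s = Fin.castLE hpn := Subsingleton.elim _ _
      rw [this]
      exact hp0
    · rw [LinearMap.smul_apply, eq_zero_of_wedgeL_eq_zero E hpn hp (hkill hI 0 _),
        eq_zero_of_wedgeL_eq_zero E hpn hp (hkill hI' 0 _), smul_zero]
  | succ d ih =>
    intro s
    rw [LinearMap.smul_apply]
    -- A factor e_i with i ≥ p lies in Dom S. Moved to the front, it is traded for a factor w on the
    -- left of the values in degree d.
    by_cases hj : ∃ j, p ≤ (s j).val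
    · obtain ⟨j, hj⟩ := hj
      have hswap : exteriorPower.ιMulti ℂ (d + 1) (e ∘ s) = Equiv.Perm.sign (Equiv.swap 0 j) •
          exteriorPower.ιMulti ℂ (d + 1) (e ∘ (s ∘ Equiv.swap 0 j)) := by
        rw [← AlternatingMap.map_perm]
        congr 1
        funext i
        simp
      obtain ⟨w, hw⟩ := hmem2 (s j) hj
      have h0 : (e ∘ (s ∘ Equiv.swap 0 j)) 0 = e (s j) := by simp
      have hmain : T' (d + 1) (exteriorPower.ιMulti ℂ (d + 1) (e ∘ (s ∘ Equiv.swap 0 j))) =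
          (c' / c) • T (d + 1) (exteriorPower.ιMulti ℂ (d + 1) (e ∘ (s ∘ Equiv.swap 0 j))) := by
        rw [ιMulti_succ, h0]
        have e1 := hI _ hw d (exteriorPower.ιMulti ℂ d (Fin.tail (e ∘ (s ∘ Equiv.swap 0 j))))
        have e2 := hI' _ hw d (exteriorPower.ιMulti ℂ d (Fin.tail (e ∘ (s ∘ Equiv.swap 0 j))))
        have e3 := ih (Fin.tail (s ∘ Equiv.swap 0 j))
        dsimp only at e1 e2
        rw [e1, e2, ← map_smul]
        exact congrArg _ e3
      rw [hswap, Units.smul_def, map_zsmul, map_zsmul, hmain, smul_comm]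
    -- All indices are now < p. Without repetition there are at most p of them: fewer give zero, and
    -- exactly p give a permutation of the base case.
    · push Not at hj
      by_cases hs : Function.Injective s
      · have hcard : d + 1 ≤ p := by
          have hinj : Function.Injective (fun j => (⟨(s j).val, hj j⟩ : Fin p)) := by
            intro a b hab
            exact hs (Fin.ext (by simpa using hab))
          simpa using Fintype.card_le_of_injective _ hinj
        rcases hcard.lt_or_eq with hlt | heq
        · rw [eq_zero_of_wedgeL_eq_zero E hpn hlt (hkill hI (d + 1) _),
            eq_zero_of_wedgeL_eq_zero E hpn hlt (hkill hI' (d + 1) _), smul_zero]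
        · subst heq
          have hrange : Set.range s = Set.range (Fin.castLE hpn) := by
            have hbij : Function.Bijective (fun j => (⟨(s j).val, hj j⟩ : Fin (d + 1))) := by
              rw [Finite.injective_iff_bijective.symm]
              intro a b hab
              exact hs (Fin.ext (by simpa using hab))
            ext i
            constructor
            · rintro ⟨j, rfl⟩
              exact ⟨⟨(s j).val, hj j⟩, rfl⟩
            · rintro ⟨j, rfl⟩
              obtain ⟨k, hk⟩ := hbij.2 j
              exact ⟨k, Fin.ext (by simpa using congrArg Fin.val hk)⟩
          obtain ⟨σ, rfl⟩ := exists_perm_of_range_eq hs (Fin.castLE_injective hpn) hrange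
          rw [← Function.comp_assoc, AlternatingMap.map_perm, Units.smul_def, map_zsmul, map_zsmul,
            hp0, smul_comm]
      · rw [ιMulti_comp_of_not_injective _ hs, map_zero, map_zero, smul_zero]

open Classical in
/-- The weight of the operator `λ(S)` for `S = stdRel e E p q`. -/
def lamWeight (p q : ℕ) (I : Finset (Fin n)) : ℂ :=
  if (∀ i : Fin n, i.val < p → i ∈ I) ∧ ∀ i ∈ I, i.val < q then 1 else 0

theorem lamWeight_image {d : ℕ} (p q : ℕ) (s : Fin d → Fin n) [Decidable (Admissible p q s)] :
    lamWeight p q (Finset.univ.image s) = if Admissible p q s then 1 else 0 := by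
  unfold lamWeight
  congr 1
  simp [Admissible]

theorem isLambda_coordOp {S : Gr n} (e E : Module.Basis (Fin n) ℂ (V n)) {p q : ℕ} (hpq : p ≤ q)
    (hqn : q ≤ n) (hS : S.1 = stdRel e E p q) : IsLambda S (coordOp e E (lamWeight p q)) := by
  classical
  refine ⟨e, E, p, q, 1, hpq, hqn, one_ne_zero, hS, fun d s => ⟨fun hs => ?_, fun hs => ?_⟩⟩
  · have hs' : Admissible p q s := hs
    rw [coordOp_ιMulti, lamWeight_image, if_pos hs']
  · have hs' : ¬ Admissible p q s := hs
    rw [coordOp_ιMulti, lamWeight_image, if_neg hs', zero_smul]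

end Lambda


/-! ### Linear relations in adapted bases -/

section Relations

variable {n : ℕ}

theorem linearIndependent_pair (e E : Module.Basis (Fin n) ℂ (V n)) (α β : Fin n → ℂ)
    (h : ∀ i, α i ≠ 0 ∨ β i ≠ 0) :
    LinearIndependent ℂ fun i => ((α i • e i, β i • E i) : V n × V n) := by
  rw [Fintype.linearIndependent_iff]
  intro g hg i
  have h1 : ∑ i, (g i * α i) • e i = 0 := by
    simpa [Prod.fst_sum, smul_smul] using congrArg Prod.fst hg
  have h2 : ∑ i, (g i * β i) • E i = 0 := by
    simpa [Prod.snd_sum, smul_smul] using congrArg Prod.snd hg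
  have h1' := Fintype.linearIndependent_iff.1 e.linearIndependent _ h1 i
  have h2' := Fintype.linearIndependent_iff.1 E.linearIndependent _ h2 i
  rcases h i with h | h
  · exact (mul_eq_zero.1 h1').resolve_right h
  · exact (mul_eq_zero.1 h2').resolve_right h

/-- This form of the spanning set, with both basis vectors always present and 0-1 coefficients, is
the one in which the relation arises as a limit of graphs. -/
theorem stdRel_eq_span_pair (e E : Module.Basis (Fin n) ℂ (V n)) {p q : ℕ} (hpq : p ≤ q)
    {α β : Fin n → ℂ} (hα : ∀ i, α i = if i.val < p then 0 else 1)
    (hβ : ∀ i, β i = if i.val < q then 1 else 0) :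
    Submodule.span ℂ (Set.range fun i => ((α i • e i, β i • E i) : V n × V n)) =
      stdRel e E p q := by
  unfold stdRel
  congr 2
  funext i
  rw [hα, hβ]
  split_ifs <;> first | omega | simp

/-- Coordinate equations for the relation, from which `Ker`, `Indef`, `Dom` and `Im` can all be read
off. -/
theorem mem_stdRel (e E : Module.Basis (Fin n) ℂ (V n)) {p q : ℕ} (hpq : p ≤ q)
    (x : V n × V n) :
    x ∈ stdRel e E p q ↔ (∀ i : Fin n, i.val < p → e.repr x.1 i = 0) ∧
      (∀ i : Fin n, q ≤ i.val → E.repr x.2 i = 0) ∧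
      ∀ i : Fin n, p ≤ i.val → i.val < q → e.repr x.1 i = E.repr x.2 i := by
  constructor
  · intro hx
    induction hx using Submodule.span_induction with
    | mem x hx =>
      obtain ⟨i, rfl⟩ := hx
      dsimp only
      refine ⟨fun j hj => ?_, fun j hj => ?_, fun j hj hj' => ?_⟩ <;> split_ifs with h1 h2 <;>
        simp only [map_zero, Finsupp.coe_zero, Pi.zero_apply, Module.Basis.repr_self,
          Finsupp.single_apply] <;> try (rw [if_neg]; rintro rfl; omega)
    | zero => simp
    | add x y _ _ hx hy =>
      refine ⟨fun i hi => ?_, fun i hi => ?_, fun i hi hi' => ?_⟩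
      · simp [hx.1 i hi, hy.1 i hi]
      · simp [hx.2.1 i hi, hy.2.1 i hi]
      · simp [hx.2.2 i hi hi', hy.2.2 i hi hi']
    | smul a x _ hx =>
      refine ⟨fun i hi => ?_, fun i hi => ?_, fun i hi hi' => ?_⟩
      · simp [hx.1 i hi]
      · simp [hx.2.1 i hi]
      · simp [hx.2.2 i hi hi']
  · rintro ⟨h1, h2, h3⟩
    have hx : x = ∑ i : Fin n, (if i.val < p then E.repr x.2 i else e.repr x.1 i) •
        (if i.val < p then ((0 : V n), E i) else if i.val < q then (e i, E i) else (e i, 0)) := by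
      refine Prod.ext ?_ ?_
      · rw [Prod.fst_sum]
        conv_lhs => rw [← e.sum_repr x.1]
        refine Finset.sum_congr rfl fun i _ => ?_
        split_ifs with hp hq
        · simp [h1 i hp]
        · rfl
        · rfl
      · rw [Prod.snd_sum]
        conv_lhs => rw [← E.sum_repr x.2]
        refine Finset.sum_congr rfl fun i _ => ?_
        split_ifs with hp hq
        · rfl
        · simp [h3 i (not_lt.1 hp) hq]
        · simp [h2 i (not_lt.1 hq)]
    rw [hx]
    exact Submodule.sum_mem _ fun i _ =>
      Submodule.smul_mem _ _ (Submodule.subset_span ⟨i, rfl⟩)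

theorem mem_relKer_stdRel (e E : Module.Basis (Fin n) ℂ (V n)) {p q : ℕ} (hpq : p ≤ q) (v : V n) :
    v ∈ relKer (stdRel e E p q) ↔ ∀ i : Fin n, i.val < q → e.repr v i = 0 := by
  rw [relKer, Submodule.mem_comap, mem_stdRel e E hpq]
  simp only [LinearMap.inl_apply, map_zero, Finsupp.coe_zero, Pi.zero_apply, implies_true,
    true_and]
  constructor
  · rintro ⟨h1, h2⟩ i hi
    by_cases hp : i.val < p
    · exact h1 i hp
    · exact h2 i (not_lt.1 hp) hi
  · intro h
    exact ⟨fun i hi => h i (by omega), fun i _ hi => h i hi⟩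

theorem mem_relIndef_stdRel (e E : Module.Basis (Fin n) ℂ (V n)) {p q : ℕ} (hpq : p ≤ q)
    (w : V n) :
    w ∈ relIndef (stdRel e E p q) ↔ ∀ i : Fin n, p ≤ i.val → E.repr w i = 0 := by
  rw [relIndef, Submodule.mem_comap, mem_stdRel e E hpq]
  simp only [LinearMap.inr_apply, map_zero, Finsupp.coe_zero, Pi.zero_apply, implies_true,
    true_and]
  constructor
  · rintro ⟨h1, h2⟩ i hi
    by_cases hq : i.val < q
    · exact (h2 i hi hq).symm
    · exact h1 i (not_lt.1 hq)
  · intro h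
    exact ⟨fun i hi => h i (by omega), fun i hi _ => (h i hi).symm⟩

theorem mem_relDom_stdRel (e E : Module.Basis (Fin n) ℂ (V n)) {p q : ℕ} (hpq : p ≤ q) (v : V n) :
    v ∈ relDom (stdRel e E p q) ↔ ∀ i : Fin n, i.val < p → e.repr v i = 0 := by
  rw [relDom, Submodule.mem_map]
  constructor
  · rintro ⟨x, hx, rfl⟩
    exact ((mem_stdRel e E hpq x).1 hx).1
  · intro h
    refine ⟨(v, ∑ i : Fin n, (if i.val < q then e.repr v i else 0) • E i), ?_, rfl⟩
    rw [mem_stdRel e E hpq]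
    refine ⟨h, fun i hi => ?_, fun i _ hi => ?_⟩
    · rw [E.repr_sum_self, if_neg (not_lt.2 hi)]
    · rw [E.repr_sum_self, if_pos hi]

theorem mem_relIm_stdRel (e E : Module.Basis (Fin n) ℂ (V n)) {p q : ℕ} (hpq : p ≤ q) (w : V n) :
    w ∈ relIm (stdRel e E p q) ↔ ∀ i : Fin n, q ≤ i.val → E.repr w i = 0 := by
  rw [relIm, Submodule.mem_map]
  constructor
  · rintro ⟨x, hx, rfl⟩
    exact ((mem_stdRel e E hpq x).1 hx).2.1
  · intro h
    refine ⟨(∑ i : Fin n, (if i.val < p then 0 else E.repr w i) • e i, w), ?_, rfl⟩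
    rw [mem_stdRel e E hpq]
    refine ⟨fun i hi => ?_, h, fun i hi _ => ?_⟩
    · rw [e.repr_sum_self, if_pos hi]
    · rw [e.repr_sum_self, if_neg (not_lt.2 hi)]

theorem finrank_relIm_stdRel (e E : Module.Basis (Fin n) ℂ (V n)) {p q : ℕ} (hpq : p ≤ q)
    (hqn : q ≤ n) : Module.finrank ℂ (relIm (stdRel e E p q)) = q := by
  have hspan : relIm (stdRel e E p q) =
      Submodule.span ℂ (Set.range (E ∘ Fin.castLE hqn)) := by
    ext w
    rw [mem_relIm_stdRel e E hpq, Set.range_comp, E.mem_span_image]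
    constructor
    · intro h i hi
      have : i.val < q := by
        by_contra hcon
        exact (Finsupp.mem_support_iff.1 hi) (h i (not_lt.1 hcon))
      exact ⟨⟨i, this⟩, rfl⟩
    · intro h i hi
      by_contra hcon
      obtain ⟨j, rfl⟩ := h (Finsupp.mem_support_iff.2 hcon)
      have := j.2
      simp only [Fin.val_castLE] at hi
      omega
  rw [hspan, finrank_span_eq_card (E.linearIndependent.comp _ (Fin.castLE_injective hqn))]
  simp

/-- The operator `e_i ↦ E_i` for `i < q`, `e_i ↦ 0` for `q ≤ i`. -/
def partialIso (e E : Module.Basis (Fin n) ℂ (V n)) (q : ℕ) : V n →ₗ[ℂ] V n :=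
  e.constr ℂ fun i => if i.val < q then E i else 0

theorem stdRel_zero_eq_graph (e E : Module.Basis (Fin n) ℂ (V n)) (q : ℕ) :
    stdRel e E 0 q = (partialIso e E q).graph := by
  ext x
  rw [mem_stdRel e E (Nat.zero_le q), LinearMap.mem_graph_iff]
  have hval : partialIso e E q x.1 = ∑ i : Fin n, (if i.val < q then e.repr x.1 i else 0) • E i := by
    rw [partialIso, Module.Basis.constr_apply_fintype]
    refine Finset.sum_congr rfl fun i _ => ?_
    split_ifs <;> simp [Module.Basis.equivFun_apply]
  rw [hval]
  constructor
  · rintro ⟨-, h2, h3⟩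
    conv_lhs => rw [← E.sum_repr x.2]
    refine Finset.sum_congr rfl fun i _ => ?_
    split_ifs with h
    · rw [h3 i (Nat.zero_le _) h]
    · rw [h2 i (not_lt.1 h)]
  · intro h
    refine ⟨fun i hi => absurd hi (Nat.not_lt_zero _), fun i hi => ?_, fun i _ hi => ?_⟩
    · rw [h, E.repr_sum_self, if_neg (not_lt.2 hi)]
    · rw [h, E.repr_sum_self, if_pos hi]

theorem coordOp_congr (e E : Module.Basis (Fin n) ℂ (V n)) {φ ψ : Finset (Fin n) → ℂ} {d : ℕ}
    (h : ∀ I : Finset (Fin n), I.card = d → φ I = ψ I) : coordOp e E φ d = coordOp e E ψ d := by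
  refine exterior_ext e fun s => ?_
  rw [coordOp_ιMulti, coordOp_ιMulti]
  by_cases hs : Function.Injective s
  · rw [h _ (by rw [Finset.card_image_of_injective _ hs]; simp)]
  · rw [ιMulti_comp_of_not_injective _ hs, smul_zero, smul_zero]

theorem lamCha_partialIso (e E : Module.Basis (Fin n) ℂ (V n)) (q : ℕ) :
    lamCha (partialIso e E q) = coordOp e E (lamWeight 0 q) := by
  classical
  funext d
  refine exterior_ext e fun s => ?_
  rw [coordOp_ιMulti, lamWeight_image, lamCha, exteriorPower.map_apply_ιMulti]
  have hval : ∀ i, partialIso e E q (e i) = if i.val < q then E i else 0 := fun i => by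
    rw [partialIso, Module.Basis.constr_basis]
  split_ifs with h
  · rw [one_smul]
    congr 1
    funext j
    simp [hval, h.2 j]
  · rw [zero_smul]
    have : ∃ j, q ≤ (s j).val := by
      by_contra! hcon
      exact h ⟨fun i hi => absurd hi (Nat.not_lt_zero _), hcon⟩
    obtain ⟨j, hj⟩ := this
    refine (exteriorPower.ιMulti ℂ d).map_coord_zero j ?_
    simp [hval, not_lt.2 hj]

theorem graphGr_injective : Function.Injective (graphGr (n := n)) := by
  intro A B h
  have h' : A.graph = B.graph := congrArg Subtype.val h
  refine LinearMap.ext fun v => ?_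
  have hv : (v, A v) ∈ B.graph := h' ▸ (LinearMap.mem_graph_iff A _).2 rfl
  exact (LinearMap.mem_graph_iff B _).1 hv

end Relations

/-! ### Hinges in adapted bases -/

section AdaptedHinge

variable {n k : ℕ}

/-- The family `P` of relations is a chain of standard relations in the bases `e`, `E`. -/
structure IsAdapted (e E : Module.Basis (Fin n) ℂ (V n)) (p q : Fin k → ℕ) (P : Fin k → Gr n) :
    Prop where
  pos : 0 < k
  lt : ∀ j, p j < q j
  le : ∀ j, q j ≤ n
  succ : ∀ i j : Fin k, i.val + 1 = j.val → q i = p j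
  first : ∀ j : Fin k, j.val = 0 → p j = 0
  last : ∀ j : Fin k, j.val + 1 = k → q j = n
  eq : ∀ j, (P j).1 = stdRel e E (p j) (q j)

variable {e E : Module.Basis (Fin n) ℂ (V n)} {p q : Fin k → ℕ} {P : Fin k → Gr n}

theorem IsAdapted.isHinge (h : IsAdapted e E p q P) : IsHinge P where
  pos := h.pos
  ker_eq_dom i j hij := by
    ext v
    rw [h.eq, h.eq, mem_relKer_stdRel e E (h.lt i).le, mem_relDom_stdRel e E (h.lt j).le,
      h.succ i j hij]
  im_eq_indef i j hij := by
    ext v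
    rw [h.eq, h.eq, mem_relIm_stdRel e E (h.lt i).le, mem_relIndef_stdRel e E (h.lt j).le,
      h.succ i j hij]
  dom_first j hj := by
    refine eq_top_iff.2 fun v _ => ?_
    rw [h.eq, mem_relDom_stdRel e E (h.lt j).le, h.first j hj]
    exact fun i hi => absurd hi (Nat.not_lt_zero _)
  im_last j hj := by
    refine eq_top_iff.2 fun v _ => ?_
    rw [h.eq, mem_relIm_stdRel e E (h.lt j).le, h.last j hj]
    exact fun i hi => absurd i.2 (not_lt.2 hi)
  ne_prod j := by
    intro heq
    -- Since p < q, the index p (counted from 0) belongs to the block [p, q). Its vector e_i ⊕ E_i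
    -- lies in the relation, while e_i is not in the kernel.
    let i : Fin n := ⟨p j, (h.lt j).trans_le (h.le j)⟩
    have hmem : (e i, E i) ∈ (P j).1 := by
      rw [h.eq]
      exact Submodule.subset_span ⟨i, by simp [i, h.lt j]⟩
    rw [heq, Submodule.mem_prod, h.eq, mem_relKer_stdRel e E (h.lt j).le] at hmem
    have := hmem.1 i (h.lt j)
    simp at this

/-- The intervals [p_j, q_j] share endpoints and run from 0 to n. The search goes down from the last
one. -/
theorem IsAdapted.exists_index (h : IsAdapted e E p q P) {d : ℕ} (hd : d ≤ n) :
    ∃ j, p j ≤ d ∧ d ≤ q j := by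
  have key : ∀ (a : ℕ) (j : Fin k), j.val = a → d ≤ q j → ∃ j, p j ≤ d ∧ d ≤ q j := by
    intro a
    induction a with
    | zero => exact fun j hj hq => ⟨j, by simp [h.first j hj], hq⟩
    | succ a ih =>
      intro j hj hq
      by_cases hp : p j ≤ d
      · exact ⟨j, hp, hq⟩
      · refine ih ⟨a, by omega⟩ rfl ?_
        rw [h.succ _ j (by simp [hj])]
        omega
  have hk := h.pos
  exact key _ ⟨k - 1, by omega⟩ rfl (by rw [h.last _ (by simp; omega)]; exact hd)

theorem coordOp_lamWeight_ne_zero (e E : Module.Basis (Fin n) ℂ (V n)) {p q d : ℕ} (hp : p ≤ d)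
    (hq : d ≤ q) (hd : d ≤ n) : coordOp e E (lamWeight p q) d ≠ 0 := by
  classical
  intro hzero
  have := coordOp_ιMulti e E (lamWeight p q) (Fin.castLE hd)
  have hadm : Admissible p q (Fin.castLE hd) :=
    ⟨fun i hi => ⟨⟨i, by omega⟩, rfl⟩, fun j => by simp; omega⟩
  rw [hzero, lamWeight_image, if_pos hadm, one_smul] at this
  exact ιMulti_comp_ne_zero E (Fin.castLE_injective hd) this.symm

theorem eq_one_of_eq_smul {W : Type*} [AddCommGroup W] [Module ℂ W] {x : W} (hx : x ≠ 0) {c : ℂ}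
    (h : x = c • x) : c = 1 := by
  have : (c - 1) • x = 0 := by rw [sub_smul, one_smul, ← h, sub_self]
  exact sub_eq_zero.1 ((smul_eq_zero.1 this).resolve_right hx)

theorem card_val_lt {p : ℕ} (hp : p ≤ n) : (Finset.univ.filter fun i : Fin n => i.val < p).card = p := by
  rw [Fin.card_filter_val_lt]
  omega

theorem lamWeight_eq_zero_of_card {p q d : ℕ} (hp : p ≤ n) {I : Finset (Fin n)}
    (hI : I.card = d) (hd : ¬ (p ≤ d ∧ d ≤ q)) : lamWeight p q I = 0 := by
  unfold lamWeight
  rw [if_neg]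
  rintro ⟨h1, h2⟩
  refine hd ⟨?_, ?_⟩
  · have hsub : (Finset.univ.filter fun i : Fin n => i.val < p) ⊆ I := fun i hi =>
      h1 i (Finset.mem_filter.1 hi).2
    have := Finset.card_le_card hsub
    rwa [card_val_lt hp, hI] at this
  · by_contra hcon
    have hsub : I ⊆ (Finset.univ.filter fun i : Fin n => i.val < q) := fun i hi =>
      Finset.mem_filter.2 ⟨Finset.mem_univ _, h2 i hi⟩
    have := Finset.card_le_card hsub
    rw [Fin.card_filter_val_lt, hI] at this
    omega

theorem coordOp_lamWeight_eq_zero (e E : Module.Basis (Fin n) ℂ (V n)) {p q d : ℕ} (hp : p ≤ n)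
    (hd : ¬ (p ≤ d ∧ d ≤ q)) : coordOp e E (lamWeight p q) d = 0 := by
  have h := coordOp_congr e E (φ := lamWeight p q) (ψ := 0) (d := d) fun I hI =>
    lamWeight_eq_zero_of_card hp hI hd
  rw [h]
  refine exterior_ext e fun s => ?_
  rw [coordOp_ιMulti]
  simp

/-- Among sets of q elements, both weights are supported on the single set {i < q}. This is the
gluing condition between neighbours in the hinge. -/
theorem lamWeight_glue {p q r : ℕ} (hp : p ≤ q) (hq : q ≤ r) (hr : r ≤ n) {I : Finset (Fin n)}
    (hI : I.card = q) : lamWeight p q I = lamWeight q r I := by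
  have hcard := card_val_lt (hq.trans hr)
  unfold lamWeight
  congr 1
  rw [eq_iff_iff]
  constructor
  · rintro ⟨h1, h2⟩
    have hsub : I ⊆ (Finset.univ.filter fun i : Fin n => i.val < q) := fun i hi =>
      Finset.mem_filter.2 ⟨Finset.mem_univ _, h2 i hi⟩
    have heq := Finset.eq_of_subset_of_card_le hsub (by omega)
    exact ⟨fun i hi => by rw [heq]; simpa using hi, fun i hi => (h2 i hi).trans_le hq⟩
  · rintro ⟨h1, h2⟩
    have hsub : (Finset.univ.filter fun i : Fin n => i.val < q) ⊆ I := fun i hi =>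
      h1 i (Finset.mem_filter.1 hi).2
    have heq := Finset.eq_of_subset_of_card_le hsub (by omega)
    exact ⟨fun i hi => h1 i (by omega), fun i hi => by rw [← heq] at hi; simpa using hi⟩

/-- The normalized operators `λ(P_j)` of an adapted hinge. -/
theorem IsAdapted.normalized (h : IsAdapted e E p q P) :
    (∀ j, IsLambda (P j) (coordOp e E (lamWeight (p j) (q j)))) ∧
    (∀ j : Fin k, j.val = 0 → ∀ A : V n →ₗ[ℂ] V n, P j = graphGr A →
      coordOp e E (lamWeight (p j) (q j)) = lamCha A) ∧
    (∀ i j : Fin k, i.val + 1 = j.val →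
      coordOp e E (lamWeight (p i) (q i)) (Module.finrank ℂ (relIm (P i).1)) =
        coordOp e E (lamWeight (p j) (q j)) (Module.finrank ℂ (relIm (P i).1))) := by
  refine ⟨fun j => isLambda_coordOp e E (h.lt j).le (h.le j) (h.eq j), fun j hj A hA => ?_,
    fun i j hij => ?_⟩
  · have hA' : graphGr (partialIso e E (q j)) = graphGr A := by
      rw [← hA]
      refine Subtype.ext ?_
      rw [h.eq, h.first j hj, stdRel_zero_eq_graph]
      rfl
    rw [← graphGr_injective hA', lamCha_partialIso, h.first j hj]
  · rw [h.eq, finrank_relIm_stdRel e E (h.lt i).le (h.le i)]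
    refine coordOp_congr e E fun I hI => ?_
    rw [← h.succ i j hij]
    exact lamWeight_glue (h.lt i).le (by rw [h.succ i j hij]; exact (h.lt j).le) (h.le j) hI

theorem IsAdapted.exists_canonical (h : IsAdapted e E p q P) :
    ∃ L : ExtOps n, IsCanonicalCollection P L := by
  classical
  obtain ⟨h1, h2, h3⟩ := h.normalized
  refine ⟨fun d => if hd : d ≤ n then
    coordOp e E (lamWeight (p (h.exists_index hd).choose) (q (h.exists_index hd).choose)) d else 0,
    fun j => coordOp e E (lamWeight (p j) (q j)), h1, h2, h3, fun d hd => ?_⟩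
  refine ⟨(h.exists_index hd).choose, ?_, ?_⟩
  · obtain ⟨hp, hq⟩ := (h.exists_index hd).choose_spec
    exact coordOp_lamWeight_ne_zero e E hp hq hd
  · exact dif_pos hd

/-- Any admissible normalization agrees with the explicit one, by induction along the hinge: the
first operator is prescribed by a graph, and gluing transports the factor. -/
theorem IsAdapted.canonical_eq (h : IsAdapted e E p q P) {L : ExtOps n}
    (hL : IsCanonicalCollection P L) {d : ℕ} (hd : d ≤ n) :
    ∃ j, p j ≤ d ∧ d ≤ q j ∧ L d = coordOp e E (lamWeight (p j) (q j)) d := by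
  obtain ⟨h1, h2, h3⟩ := h.normalized
  obtain ⟨T, hT1, hT2, hT3, hT4⟩ := hL
  have key : ∀ (a : ℕ) (j : Fin k), j.val = a → T j = coordOp e E (lamWeight (p j) (q j)) := by
    intro a
    induction a with
    | zero =>
      intro j hj
      have hA : P j = graphGr (partialIso e E (q j)) := by
        refine Subtype.ext ?_
        rw [h.eq, h.first j hj, stdRel_zero_eq_graph]
        rfl
      rw [hT2 j hj _ hA, h2 j hj _ hA]
    | succ a ih =>
      intro j hj
      let i : Fin k := ⟨a, by omega⟩
      have hij : i.val + 1 = j.val := hj.symm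
      -- The factor c is the same in all degrees. In the gluing degree q_i = p_j the operator is
      -- nonzero, which forces c = 1.
      obtain ⟨c, hc⟩ := (h1 j).unique (hT1 j)
      have hg := hT3 i j hij
      rw [ih i rfl, h3 i j hij, hc, h.eq, finrank_relIm_stdRel e E (h.lt i).le (h.le i)] at hg
      have hne : coordOp e E (lamWeight (p j) (q j)) (q i) ≠ 0 :=
        coordOp_lamWeight_ne_zero e E (h.succ i j hij).ge
          (by rw [h.succ i j hij]; exact (h.lt j).le) (h.le i)
      have hc1 : c = 1 := eq_one_of_eq_smul (W := Module.End ℂ (⋀[ℂ]^(q i) (V n))) hne hg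
      funext d
      rw [hc d, hc1, one_smul]
  obtain ⟨j, hj, hLj⟩ := hT4 d hd
  rw [key _ j rfl] at hj hLj
  have hpq : p j ≤ d ∧ d ≤ q j := by
    by_contra hcon
    exact hj (coordOp_lamWeight_eq_zero e E ((h.lt j).le.trans (h.le j)) hcon)
  exact ⟨j, hpq.1, hpq.2, hLj⟩

end AdaptedHinge


/-! ### Existence of exponents -/

section Exponents

open Matrix

variable {ι κ : Type} [Fintype ι] [DecidableEq ι] [Fintype κ] [DecidableEq κ]

/-- Germs at `0` of holomorphic maps to the invertible matrices, for general index types. -/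
def HolGL (a : ℂ → Matrix ι ι ℂ) : Prop :=
  (∀ i j, AnalyticAt ℂ (fun z => a z i j) 0) ∧ IsUnit (a 0)

theorem HolGL.mul {a b : ℂ → Matrix ι ι ℂ} (ha : HolGL a) (hb : HolGL b) :
    HolGL fun z => a z * b z := by
  refine ⟨fun i j => ?_, ha.2.mul hb.2⟩
  simp only [Matrix.mul_apply]
  exact Finset.analyticAt_fun_sum _ fun l _ => (ha.1 i l).mul (hb.1 l j)

theorem HolGL.submatrix {a : ℂ → Matrix ι ι ℂ} (ha : HolGL a) (e f : κ ≃ ι) :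
    HolGL fun z => (a z).submatrix e f :=
  ⟨fun i j => ha.1 (e i) (f j), (Matrix.isUnit_submatrix_equiv _ _).2 ha.2⟩

/-- `γ = a diag(z^{-m}) b` with holomorphic invertible `a`, `b`. -/
def HasDiagonalForm (γ : ℂ → Matrix ι ι ℂ) (m : ι → ℤ) : Prop :=
  ∃ a b : ℂ → Matrix ι ι ℂ, HolGL a ∧ HolGL b ∧
    ∀ᶠ z in 𝓝[≠] (0 : ℂ), γ z = a z * Matrix.diagonal (fun i => z ^ (-m i)) * b z

theorem HasDiagonalForm.submatrix {γ : ℂ → Matrix ι ι ℂ} {m : ι → ℤ} (h : HasDiagonalForm γ m)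
    (e f : κ ≃ ι) : HasDiagonalForm (fun z => (γ z).submatrix e f) (m ∘ e) := by
  obtain ⟨a, b, ha, hb, hγ⟩ := h
  refine ⟨_, _, ha.submatrix e e, hb.submatrix e f, ?_⟩
  filter_upwards [hγ] with z hz
  have hD : Matrix.diagonal (fun i => z ^ (-(m ∘ e) i)) =
      (Matrix.diagonal (fun i => z ^ (-m i))).submatrix e e :=
    (Matrix.submatrix_diagonal_equiv (fun i => z ^ (-m i)) e).symm
  rw [hz, hD, Matrix.submatrix_mul_equiv, Matrix.submatrix_mul_equiv]

theorem HasDiagonalForm.of_mul {γ γ' a b : ℂ → Matrix ι ι ℂ} {m : ι → ℤ}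
    (h : HasDiagonalForm γ m) (ha : HolGL a) (hb : HolGL b)
    (hγ : ∀ᶠ z in 𝓝[≠] (0 : ℂ), γ' z = a z * γ z * b z) : HasDiagonalForm γ' m := by
  obtain ⟨a', b', ha', hb', hγ'⟩ := h
  refine ⟨_, _, ha.mul ha', hb'.mul hb, ?_⟩
  filter_upwards [hγ, hγ'] with z h1 h2
  rw [h1, h2]
  simp only [Matrix.mul_assoc]

/-- A common power of `z` splits off, so that some entry becomes invertible. -/
theorem exists_pivot [Nonempty ι] {γ : ℂ → Matrix ι ι ℂ}
    (hmer : ∀ i j, MeromorphicAt (fun z => γ z i j) 0)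
    (hunit : ∀ᶠ z in 𝓝[≠] (0 : ℂ), IsUnit (γ z)) :
    ∃ (k : ℤ) (i₀ j₀ : ι) (G : ℂ → Matrix ι ι ℂ), (∀ i j, AnalyticAt ℂ (fun z => G z i j) 0) ∧
      G 0 i₀ j₀ ≠ 0 ∧ ∀ᶠ z in 𝓝[≠] (0 : ℂ), γ z = z ^ k • G z := by
  -- The pivot is an entry of least order. That order is finite, as otherwise γ would vanish near
  -- `0`; after division by z^k every entry is holomorphic.
  obtain ⟨⟨i₀, j₀⟩, hmin⟩ := Finite.exists_min
    fun x : ι × ι => meromorphicOrderAt (fun z => γ z x.1 x.2) 0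
  have hne : meromorphicOrderAt (fun z => γ z i₀ j₀) 0 ≠ ⊤ := by
    intro htop
    have hall : ∀ x : ι × ι, ∀ᶠ z in 𝓝[≠] (0 : ℂ), γ z x.1 x.2 = 0 := by
      intro x
      have := hmin x
      simp only [htop, top_le_iff] at this
      exact meromorphicOrderAt_eq_top_iff.1 this
    obtain ⟨z, hz, hu⟩ := ((eventually_all.2 hall).and hunit).exists
    have h0 : γ z = 0 := Matrix.ext fun i j => hz (i, j)
    rw [h0] at hu
    exact not_isUnit_zero hu
  obtain ⟨k, hk⟩ := WithTop.ne_top_iff_exists.1 hne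
  have key : ∀ i j, ∃ g : ℂ → ℂ, AnalyticAt ℂ g 0 ∧
      (∀ᶠ z in 𝓝[≠] (0 : ℂ), γ z i j = z ^ k * g z) ∧ (i = i₀ ∧ j = j₀ → g 0 ≠ 0) := by
    intro i j
    have hle := hmin (i, j)
    dsimp only at hle
    rw [← hk] at hle
    by_cases htop : meromorphicOrderAt (fun z => γ z i j) 0 = ⊤
    · refine ⟨0, analyticAt_const, ?_, ?_⟩
      · filter_upwards [meromorphicOrderAt_eq_top_iff.1 htop] with z hz
        simp [hz]
      · rintro ⟨rfl, rfl⟩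
        exact absurd htop hne
    · obtain ⟨l, hl⟩ := WithTop.ne_top_iff_exists.1 htop
      obtain ⟨g, hg, hg0, hgz⟩ := (meromorphicOrderAt_eq_int_iff (hmer i j)).1 hl.symm
      rw [← hl] at hle
      have hkl : k ≤ l := by exact_mod_cast hle
      refine ⟨fun z => z ^ (l - k).toNat * g z, (analyticAt_id.pow _).mul hg, ?_, ?_⟩
      · filter_upwards [hgz, self_mem_nhdsWithin] with z hz hz0
        rw [hz, sub_zero, smul_eq_mul, ← mul_assoc, ← zpow_natCast, ← zpow_add₀ hz0]
        congr 2
        omega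
      · rintro ⟨rfl, rfl⟩
        have : l = k := by
          rw [← hk] at hl
          exact_mod_cast hl
        simp [this, hg0]
  choose g hg1 hg2 hg3 using key
  refine ⟨k, i₀, j₀, fun z => Matrix.of fun i j => g i j z, hg1, hg3 _ _ ⟨rfl, rfl⟩, ?_⟩
  filter_upwards [eventually_all.2 fun i => eventually_all.2 fun j => hg2 i j] with z hz
  ext i j
  simp [hz i j]

theorem holGL_one : HolGL fun _ : ℂ => (1 : Matrix ι ι ℂ) :=
  ⟨fun _ _ => analyticAt_const, isUnit_one⟩

theorem HolGL.fromBlocks {A : ℂ → Matrix ι ι ℂ} {B : ℂ → Matrix ι κ ℂ} {C : ℂ → Matrix κ ι ℂ}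
    {D : ℂ → Matrix κ κ ℂ} (hA : HolGL A) (hB : ∀ i j, AnalyticAt ℂ (fun z => B z i j) 0)
    (hC : ∀ i j, AnalyticAt ℂ (fun z => C z i j) 0) (hD : HolGL D) (h0 : B 0 = 0 ∨ C 0 = 0) :
    HolGL fun z => Matrix.fromBlocks (A z) (B z) (C z) (D z) := by
  refine ⟨?_, ?_⟩
  · rintro (i | i) (j | j)
    · exact hA.1 i j
    · exact hB i j
    · exact hC i j
    · exact hD.1 i j
  · dsimp only
    rw [Matrix.isUnit_iff_isUnit_det]
    have h1 := (Matrix.isUnit_iff_isUnit_det _).1 hA.2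
    have h2 := (Matrix.isUnit_iff_isUnit_det _).1 hD.2
    rcases h0 with h | h
    · rw [h, Matrix.det_fromBlocks_zero₁₂]
      exact h1.mul h2
    · rw [h, Matrix.det_fromBlocks_zero₂₁]
      exact h1.mul h2

theorem HasDiagonalForm.fromBlocks {γ : ℂ → Matrix ι ι ℂ} {δ : ℂ → Matrix κ κ ℂ} {m : ι → ℤ}
    {l : κ → ℤ} (hγ : HasDiagonalForm γ m) (hδ : HasDiagonalForm δ l) :
    HasDiagonalForm (fun z => Matrix.fromBlocks (γ z) 0 0 (δ z)) (Sum.elim m l) := by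
  obtain ⟨a, b, ha, hb, h1⟩ := hγ
  obtain ⟨c, d, hc, hd, h2⟩ := hδ
  refine ⟨_, _, ha.fromBlocks (B := 0) (C := 0) (fun _ _ => analyticAt_const)
    (fun _ _ => analyticAt_const) hc (Or.inl rfl),
    hb.fromBlocks (B := 0) (C := 0) (fun _ _ => analyticAt_const)
    (fun _ _ => analyticAt_const) hd (Or.inl rfl), ?_⟩
  filter_upwards [h1, h2] with z h1 h2
  have hD : Matrix.diagonal (fun i => z ^ (-Sum.elim m l i)) =
      Matrix.fromBlocks (Matrix.diagonal fun i => z ^ (-m i)) 0 0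
        (Matrix.diagonal fun i => z ^ (-l i)) := by
    rw [Matrix.fromBlocks_diagonal]
    congr 1
    funext i
    rcases i with i | i <;> rfl
  rw [hD, h1, h2]
  simp only [Matrix.fromBlocks_multiply, Pi.zero_apply, Matrix.zero_mul, Matrix.mul_zero,
    add_zero, zero_add]

/-- Block elimination with a Schur complement. For a pivot holomorphic and nonzero at `0` the
triangular factors are holomorphic and invertible. -/
theorem fromBlocks_pivot {R : Type*} [Field R] {u : R} (hu : u ≠ 0) (B : Matrix Unit κ R)
    (C : Matrix κ Unit R) (D : Matrix κ κ R) :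
    Matrix.fromBlocks (Matrix.of fun _ _ => u) B C D =
      Matrix.fromBlocks 1 0 (u⁻¹ • C) 1 *
        Matrix.fromBlocks (Matrix.of fun _ _ => u) 0 0 (D - u⁻¹ • (C * B)) *
        Matrix.fromBlocks 1 (u⁻¹ • B) 0 1 := by
  have h1 : (Matrix.of fun _ _ => u : Matrix Unit Unit R) = u • 1 := by
    ext
    simp
  rw [h1]
  simp [Matrix.fromBlocks_multiply, smul_smul, hu]

/-- Smith form over the germs at `0`: permute the pivot into the corner, eliminate its row and
column, and recurse on the Schur complement, which is again a meromorphic invertible family. -/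
theorem exists_hasDiagonalForm (n : ℕ) : ∀ γ : ℂ → Matrix (Fin n) (Fin n) ℂ,
    (∀ i j, MeromorphicAt (fun z => γ z i j) 0) → (∀ᶠ z in 𝓝[≠] (0 : ℂ), IsUnit (γ z)) →
      ∃ m, HasDiagonalForm γ m := by
  induction n with
  | zero =>
    intro γ _ _
    exact ⟨0, 1, 1, holGL_one, holGL_one, Eventually.of_forall fun z => Subsingleton.elim _ _⟩
  | succ n ih =>
    intro γ hmer hunit
    obtain ⟨k, i₀, j₀, G, hG, hG0, hγ⟩ := exists_pivot hmer hunit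
    obtain ⟨e₀⟩ : Nonempty (Unit ⊕ Fin n ≃ Fin (n + 1)) :=
      ⟨Fintype.equivOfCardEq (by simp; ring)⟩
    let e : Unit ⊕ Fin n ≃ Fin (n + 1) := e₀.trans (Equiv.swap (e₀ (Sum.inl ())) i₀)
    let f : Unit ⊕ Fin n ≃ Fin (n + 1) := e₀.trans (Equiv.swap (e₀ (Sum.inl ())) j₀)
    have he : e (Sum.inl ()) = i₀ := by simp [e]
    have hf : f (Sum.inl ()) = j₀ := by simp [f]
    let u : ℂ → ℂ := fun z => G z i₀ j₀
    let B : ℂ → Matrix Unit (Fin n) ℂ := fun z => Matrix.of fun _ j => G z i₀ (f (Sum.inr j))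
    let C : ℂ → Matrix (Fin n) Unit ℂ := fun z => Matrix.of fun i _ => G z (e (Sum.inr i)) j₀
    let D : ℂ → Matrix (Fin n) (Fin n) ℂ := fun z =>
      Matrix.of fun i j => G z (e (Sum.inr i)) (f (Sum.inr j))
    have hu : AnalyticAt ℂ u 0 := hG _ _
    have hu0 : u 0 ≠ 0 := hG0
    have hblocks : ∀ z, (G z).submatrix e f =
        Matrix.fromBlocks (Matrix.of fun _ _ => u z) (B z) (C z) (D z) := by
      intro z
      ext (i | i) (j | j) <;> simp [u, B, C, D, ← he, ← hf]
    have hL : HolGL fun z => Matrix.fromBlocks (1 : Matrix Unit Unit ℂ) 0 ((u z)⁻¹ • C z)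
        (1 : Matrix (Fin n) (Fin n) ℂ) :=
      HolGL.fromBlocks (B := 0) holGL_one (fun _ _ => analyticAt_const)
        (fun i j => (hu.inv hu0).mul (hG _ _)) holGL_one (Or.inl rfl)
    have hR : HolGL fun z => Matrix.fromBlocks (1 : Matrix Unit Unit ℂ) ((u z)⁻¹ • B z) 0
        (1 : Matrix (Fin n) (Fin n) ℂ) :=
      HolGL.fromBlocks (C := 0) holGL_one (fun i j => (hu.inv hu0).mul (hG _ _))
        (fun _ _ => analyticAt_const) holGL_one (Or.inr rfl)
    let S : ℂ → Matrix (Fin n) (Fin n) ℂ := fun z => z ^ k • (D z - (u z)⁻¹ • (C z * B z))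
    have hune : ∀ᶠ z in 𝓝[≠] (0 : ℂ), u z ≠ 0 :=
      (hu.continuousAt.eventually_ne hu0).filter_mono nhdsWithin_le_nhds
    have hfac : ∀ᶠ z in 𝓝[≠] (0 : ℂ), (γ z).submatrix e f =
        Matrix.fromBlocks 1 0 ((u z)⁻¹ • C z) 1 *
          Matrix.fromBlocks (Matrix.of fun _ _ => z ^ k * u z) 0 0 (S z) *
          Matrix.fromBlocks 1 ((u z)⁻¹ • B z) 0 1 := by
      filter_upwards [hγ, hune] with z hz huz
      have hscale : Matrix.fromBlocks (Matrix.of fun _ _ => z ^ k * u z) 0 0 (S z) =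
          z ^ k • Matrix.fromBlocks (Matrix.of fun _ _ : Unit => u z) 0 0
            (D z - (u z)⁻¹ • (C z * B z)) := by
        rw [Matrix.fromBlocks_smul, smul_zero, smul_zero]
        rfl
      rw [hscale, Matrix.mul_smul, Matrix.smul_mul, ← fromBlocks_pivot huz, ← hblocks, hz]
      rfl
    have hSmer : ∀ i j, MeromorphicAt (fun z => S z i j) 0 := by
      intro i j
      refine ((MeromorphicAt.id 0).fun_zpow k).fun_mul (AnalyticAt.meromorphicAt ?_)
      refine (hG _ _).sub ((hu.inv hu0).mul ?_)
      simp only [Matrix.mul_apply]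
      exact Finset.analyticAt_fun_sum _ fun l _ => (hG _ _).mul (hG _ _)
    have hSunit : ∀ᶠ z in 𝓝[≠] (0 : ℂ), IsUnit (S z) := by
      filter_upwards [hfac, hunit] with z hz hzu
      have h1 := (Matrix.isUnit_submatrix_equiv e f).2 hzu
      rw [hz, Matrix.isUnit_iff_isUnit_det, Matrix.det_mul, Matrix.det_mul,
        Matrix.det_fromBlocks_zero₁₂, Matrix.det_fromBlocks_zero₂₁,
        Matrix.det_fromBlocks_zero₂₁] at h1
      rw [Matrix.isUnit_iff_isUnit_det]
      exact isUnit_of_mul_isUnit_right (isUnit_of_mul_isUnit_right (isUnit_of_mul_isUnit_left h1))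
    obtain ⟨m, hm⟩ := ih S hSmer hSunit
    -- The exponent is -k because diagonal forms carry z^{-m}; the unit `u` goes into the left
    -- factor.
    have hpiv : HasDiagonalForm (fun z => (Matrix.of fun _ _ : Unit => z ^ k * u z))
        (fun _ : Unit => -k) := by
      refine ⟨fun z => Matrix.of fun _ _ => u z, fun _ => 1, ⟨fun _ _ => hu, ?_⟩, holGL_one, ?_⟩
      · rw [Matrix.isUnit_iff_isUnit_det]
        simpa using hu0
      · refine Eventually.of_forall fun z => ?_
        ext
        simp [mul_comm]
    have hsub : HasDiagonalForm (fun z => (γ z).submatrix e f) (Sum.elim (fun _ => -k) m) :=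
      (hpiv.fromBlocks hm).of_mul hL hR hfac
    refine ⟨Sum.elim (fun _ => -k) m ∘ e.symm, ?_⟩
    have := hsub.submatrix e.symm f.symm
    simpa using this

theorem exists_isExponents {n : ℕ} {γ : ℂ → Matrix (Fin n) (Fin n) ℂ}
    (hγ : IsMeromorphicFamily γ) : ∃ m, IsExponents γ m := by
  obtain ⟨m, hm⟩ := exists_hasDiagonalForm n γ hγ.1 hγ.2
  -- Sorting in the dual order makes the exponents decreasing. The permutation is absorbed into a
  -- and b.
  let σ : Equiv.Perm (Fin n) := Tuple.sort (OrderDual.toDual ∘ m)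
  have hσ : Antitone (m ∘ σ) := fun i j hij => Tuple.monotone_sort (OrderDual.toDual ∘ m) hij
  have h1 : HasDiagonalForm γ (m ∘ σ) := by
    obtain ⟨a, b, ha, hb, h⟩ := hm
    refine ⟨_, _, ha.submatrix (Equiv.refl _) σ, hb.submatrix σ (Equiv.refl _), ?_⟩
    filter_upwards [h] with z hz
    have hD : Matrix.diagonal (fun i => z ^ (-(m ∘ σ) i)) =
        (Matrix.diagonal (fun i => z ^ (-m i))).submatrix σ σ :=
      (Matrix.submatrix_diagonal_equiv (fun i => z ^ (-m i)) σ).symm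
    rw [hz, hD, Matrix.submatrix_mul_equiv, Matrix.submatrix_mul_equiv]
    rfl
  exact ⟨m ∘ σ, hσ, h1⟩

end Exponents


/-! ### Numbering the exponents -/

section Indices

variable {n : ℕ}

/-- The number of exponents greater than `k`. -/
def numGt (m : Fin n → ℤ) (k : ℤ) : ℕ := (Finset.univ.filter fun i => k < m i).card

/-- The number of exponents not less than `k`. -/
def numGe (m : Fin n → ℤ) (k : ℤ) : ℕ := (Finset.univ.filter fun i => k ≤ m i).card

/-- For decreasing m the indices counted form an initial segment, so counts serve as the thresholds
p and q. -/
theorem lt_numGt_iff {m : Fin n → ℤ} (hm : Antitone m) {k : ℤ} {i : Fin n} :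
    i.val < numGt m k ↔ k < m i :=
  Tuple.lt_card_gt_iff_apply_gt_of_antitone hm

theorem lt_numGe_iff {m : Fin n → ℤ} (hm : Antitone m) {k : ℤ} {i : Fin n} :
    i.val < numGe m k ↔ k ≤ m i :=
  Tuple.lt_card_ge_iff_apply_ge_of_antitone hm

theorem numGe_le (m : Fin n → ℤ) (k : ℤ) : numGe m k ≤ n :=
  (Finset.card_le_univ _).trans (by simp)

theorem numGt_le_numGe (m : Fin n → ℤ) (k : ℤ) : numGt m k ≤ numGe m k :=
  Finset.card_le_card fun i hi => by
    simp only [Finset.mem_filter] at hi ⊢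
    exact ⟨hi.1, hi.2.le⟩

theorem distinctExp_strictAnti (m : Fin n → ℤ) : StrictAnti (distinctExp m) := by
  intro i j hij
  exact (Finset.orderEmbOfFin _ rfl).strictMono (Fin.rev_lt_rev.2 hij)

theorem exists_distinctExp_eq (m : Fin n → ℤ) (i : Fin n) : ∃ j, distinctExp m j = m i := by
  have : m i ∈ Set.range ((Finset.univ.image m).orderEmbOfFin rfl) := by
    rw [Finset.range_orderEmbOfFin]
    simp
  obtain ⟨l, hl⟩ := this
  exact ⟨l.rev, (congrArg _ (Fin.rev_rev l)).trans hl⟩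

theorem exists_eq_distinctExp (m : Fin n → ℤ) (j : Fin (numExp m)) :
    ∃ i, m i = distinctExp m j := by
  have : distinctExp m j ∈ Finset.univ.image m := Finset.orderEmbOfFin_mem _ _ _
  simpa using this

theorem numGt_lt_numGe (m : Fin n → ℤ) (j : Fin (numExp m)) :
    numGt m (distinctExp m j) < numGe m (distinctExp m j) := by
  obtain ⟨i, hi⟩ := exists_eq_distinctExp m j
  refine Finset.card_lt_card (Finset.ssubset_iff_of_subset ?_ |>.2 ⟨i, ?_, ?_⟩)
  · intro l hl
    simp only [Finset.mem_filter] at hl ⊢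
    exact ⟨hl.1, hl.2.le⟩
  · simp [hi]
  · simp [hi]

/-- No exponent lies strictly between two consecutive distinct values, so ≥ the larger means > the
smaller. -/
theorem numGe_eq_numGt_succ (m : Fin n → ℤ) {i j : Fin (numExp m)} (hij : i.val + 1 = j.val) :
    numGe m (distinctExp m i) = numGt m (distinctExp m j) := by
  unfold numGe numGt
  congr 1
  ext l
  obtain ⟨a, ha⟩ := exists_distinctExp_eq m l
  simp only [Finset.mem_filter, Finset.mem_univ, true_and]
  rw [← ha, (distinctExp_strictAnti m).le_iff_ge, (distinctExp_strictAnti m).lt_iff_gt, Fin.le_def,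
    Fin.lt_def]
  omega

theorem numGt_first (m : Fin n → ℤ) {j : Fin (numExp m)} (hj : j.val = 0) :
    numGt m (distinctExp m j) = 0 := by
  unfold numGt
  rw [Finset.card_eq_zero, Finset.filter_eq_empty_iff]
  intro l _
  obtain ⟨a, ha⟩ := exists_distinctExp_eq m l
  rw [← ha, (distinctExp_strictAnti m).lt_iff_gt, Fin.lt_def]
  omega

theorem numGe_last (m : Fin n → ℤ) {j : Fin (numExp m)} (hj : j.val + 1 = numExp m) :
    numGe m (distinctExp m j) = n := by
  unfold numGe
  rw [Finset.filter_true_of_mem, Finset.card_univ, Fintype.card_fin]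
  intro l _
  obtain ⟨a, ha⟩ := exists_distinctExp_eq m l
  rw [← ha, (distinctExp_strictAnti m).le_iff_ge, Fin.le_def]
  omega

theorem numExp_pos (hn : 0 < n) (m : Fin n → ℤ) : 0 < numExp m := by
  unfold numExp
  rw [Finset.card_pos]
  exact ⟨m ⟨0, hn⟩, Finset.mem_image_of_mem _ (Finset.mem_univ _)⟩

end Indices

/-! ### Limits in the Grassmannian -/

section Limits

variable {n : ℕ}

/-- The basis formed by the columns of an invertible matrix. -/
def colBasis (a : Matrix (Fin n) (Fin n) ℂ) (ha : IsUnit a) : Module.Basis (Fin n) ℂ (V n) :=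
  (Pi.basisFun ℂ (Fin n)).map (Matrix.toLin'OfInv
    (Matrix.nonsing_inv_mul a ((Matrix.isUnit_iff_isUnit_det a).1 ha))
    (Matrix.mul_nonsing_inv a ((Matrix.isUnit_iff_isUnit_det a).1 ha)))

theorem colBasis_apply (a : Matrix (Fin n) (Fin n) ℂ) (ha : IsUnit a) (i : Fin n) :
    colBasis a ha i = a.toLin' (Pi.single i 1) := by
  unfold colBasis
  rw [Module.Basis.map_apply, Pi.basisFun_apply]
  rfl

theorem colBasis_apply_col (a : Matrix (Fin n) (Fin n) ℂ) (ha : IsUnit a) (i : Fin n) :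
    colBasis a ha i = a.col i := by
  simp [colBasis_apply]

theorem continuous_frame_toGr : Continuous (Frame.toGr (n := n)) := continuous_coinduced_rng

theorem HolGL.continuousAt {a : ℂ → Matrix (Fin n) (Fin n) ℂ} (ha : IsHolomorphicGL a) :
    ContinuousAt a 0 :=
  continuousAt_pi.2 fun i => continuousAt_pi.2 fun j => (ha.1 i j).continuousAt

theorem HolGL.continuousAt_inv {a : ℂ → Matrix (Fin n) (Fin n) ℂ} (ha : IsHolomorphicGL a) :
    ContinuousAt (fun z => (a z)⁻¹) 0 := by
  refine ContinuousAt.comp (g := fun x : Matrix (Fin n) (Fin n) ℂ => x⁻¹) ?_ (HolGL.continuousAt ha)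
  refine continuousAt_matrix_inv _ ?_
  have : (a 0).det ≠ 0 := ((Matrix.isUnit_iff_isUnit_det _).1 ha.2).ne_zero
  rw [Ring.inverse_eq_inv']
  exact continuousAt_inv₀ this

theorem HolGL.eventually_isUnit {a : ℂ → Matrix (Fin n) (Fin n) ℂ} (ha : IsHolomorphicGL a) :
    ∀ᶠ z in 𝓝 (0 : ℂ), IsUnit (a z) := by
  have h0 : (a 0).det ≠ 0 := ((Matrix.isUnit_iff_isUnit_det _).1 ha.2).ne_zero
  have hc : ContinuousAt (fun z => (a z).det) 0 :=
    ContinuousAt.comp (g := Matrix.det) (Continuous.matrix_det continuous_id).continuousAt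
      (HolGL.continuousAt ha)
  filter_upwards [hc.eventually_ne h0] with z hz
  exact (Matrix.isUnit_iff_isUnit_det _).2 (isUnit_iff_ne_zero.2 hz)

/-- A family of frames that is continuous at a point has a limit in the Grassmannian. -/
theorem tendsto_span_frame {f : ℂ → Fin n → V n × V n} (hf : ContinuousAt f 0)
    (h0 : LinearIndependent ℂ (f 0)) {S : ℂ → Gr n} {P : Gr n}
    (hP : P.1 = Submodule.span ℂ (Set.range (f 0)))
    (hS : ∀ᶠ z in 𝓝[≠] (0 : ℂ), LinearIndependent ℂ (f z) ∧
      (S z).1 = Submodule.span ℂ (Set.range (f z))) :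
    Tendsto S (𝓝[≠] 0) (𝓝 P) := by
  classical
  -- The default value only makes F total; it does not occur near `0`.
  let F : ℂ → Frame n := fun z => if h : LinearIndependent ℂ (f z) then ⟨f z, h⟩ else ⟨f 0, h0⟩
  have hF0 : (F 0).toGr = P := by
    refine Subtype.ext ?_
    rw [hP]
    simp [F, h0, Frame.toGr]
  have hF : Tendsto F (𝓝[≠] 0) (𝓝 (F 0)) := by
    rw [tendsto_subtype_rng]
    have hval : (F 0).1 = f 0 := by simp [F, h0]
    rw [hval]
    refine (hf.tendsto.mono_left nhdsWithin_le_nhds).congr' ?_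
    filter_upwards [hS] with z hz
    simp [F, hz.1]
  rw [← hF0]
  refine ((continuous_frame_toGr.tendsto _).comp hF).congr' ?_
  filter_upwards [hS] with z hz
  refine Subtype.ext ?_
  rw [hz.2]
  simp [F, hz.1, Frame.toGr]

/-- Since γ sends the i-th column of b⁻¹ to z^{-m_i} times that of a, the graph of z^k γ has an
explicit frame, which extends continuously to z = 0 after rescaling. -/
theorem tendsto_graph {γ a b : ℂ → Matrix (Fin n) (Fin n) ℂ} {m : Fin n → ℤ} (hm : Antitone m)
    (ha : IsHolomorphicGL a) (hb : IsHolomorphicGL b)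
    (hγ : ∀ᶠ z in 𝓝[≠] (0 : ℂ), γ z = a z * Matrix.diagonal (fun i => z ^ (-m i)) * b z) (k : ℤ)
    (hb' : IsUnit (b 0)⁻¹) {P : Gr n}
    (hP : P.1 = stdRel (colBasis (b 0)⁻¹ hb') (colBasis (a 0) ha.2) (numGt m k) (numGe m k)) :
    Tendsto (fun z : ℂ => graphGr (z ^ k • (γ z).toLin')) (𝓝[≠] 0) (𝓝 P) := by
  -- Truncation by `toNat` is the rescaling by z^{max(m_i-k, 0)}. At most one of the two powers is
  -- nontrivial, so no vector vanishes; at z = 0, by 0^0 = 1, the powers become the 0-1 coefficients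
  -- of the standard relation.
  let f : ℂ → Fin n → V n × V n := fun z i =>
    (z ^ (m i - k).toNat • ((b z)⁻¹).col i, z ^ (k - m i).toNat • (a z).col i)
  have hfpair : ∀ z (h1 : IsUnit (b z)⁻¹) (h2 : IsUnit (a z)), f z = fun i =>
      (z ^ (m i - k).toNat • colBasis (b z)⁻¹ h1 i, z ^ (k - m i).toNat • colBasis (a z) h2 i) := by
    intro z h1 h2
    funext i
    simp only [f, colBasis_apply_col]
  have hne : ∀ (z : ℂ) i, z ^ (m i - k).toNat ≠ 0 ∨ z ^ (k - m i).toNat ≠ 0 := by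
    intro z i
    rcases le_total (m i) k with h | h
    · left
      have : (m i - k).toNat = 0 := by omega
      simp [this]
    · right
      have : (k - m i).toNat = 0 := by omega
      simp [this]
  have hind : ∀ z, IsUnit (b z)⁻¹ → IsUnit (a z) → LinearIndependent ℂ (f z) := by
    intro z h1 h2
    rw [hfpair z h1 h2]
    exact linearIndependent_pair _ _ _ _ (hne z)
  refine tendsto_span_frame (f := f) ?_ (hind 0 hb' ha.2) ?_ ?_
  · refine continuousAt_pi.2 fun i => ContinuousAt.prodMk ?_ ?_
    · refine (continuousAt_id.pow _).smul (continuousAt_pi.2 fun j => ?_)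
      exact continuousAt_pi.1 (continuousAt_pi.1 (HolGL.continuousAt_inv hb) j) i
    · refine (continuousAt_id.pow _).smul (continuousAt_pi.2 fun j => ?_)
      exact (ha.1 j i).continuousAt
  · rw [hP, hfpair 0 hb' ha.2]
    refine (stdRel_eq_span_pair _ _ (numGt_le_numGe m k) (fun i => ?_) (fun i => ?_)).symm
    · simp only [lt_numGt_iff hm]
      split_ifs with h
      · exact zero_pow (by omega)
      · have : (m i - k).toNat = 0 := by omega
        simp [this]
    · simp only [lt_numGe_iff hm]
      split_ifs with h
      · have : (k - m i).toNat = 0 := by omega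
        simp [this]
      · exact zero_pow (by omega)
  · filter_upwards [hγ, (HolGL.eventually_isUnit ha).filter_mono nhdsWithin_le_nhds,
      (HolGL.eventually_isUnit hb).filter_mono nhdsWithin_le_nhds, self_mem_nhdsWithin]
      with z hz haz hbz hz0
    have hbdet := (Matrix.isUnit_iff_isUnit_det _).1 hbz
    have hbz' : IsUnit (b z)⁻¹ := Matrix.isUnit_nonsing_inv_iff.2 hbz
    have hli := hind z hbz' haz
    refine ⟨hli, (Submodule.eq_of_le_of_finrank_eq ?_ ?_).symm⟩
    · rw [Submodule.span_le]
      rintro _ ⟨i, rfl⟩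
      change f z i ∈ (z ^ k • (γ z).toLin').graph
      rw [LinearMap.mem_graph_iff]
      simp only [f, LinearMap.smul_apply, map_smul, Matrix.toLin'_apply]
      have h1 : (γ z).mulVec ((b z)⁻¹.col i) = z ^ (-m i) • (a z).col i := by
        rw [← Matrix.mulVec_single_one (b z)⁻¹, Matrix.mulVec_mulVec, hz, Matrix.mul_assoc,
          Matrix.mul_nonsing_inv _ hbdet, Matrix.mul_one, ← Matrix.mulVec_mulVec,
          Matrix.diagonal_mulVec_single, mul_one, ← Matrix.mulVec_single_one (a z),
          ← Matrix.mulVec_smul]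
        congr 1
        rw [← Pi.single_smul, smul_eq_mul, mul_one]
      rw [h1, smul_smul, smul_smul, ← zpow_natCast, ← zpow_natCast, ← zpow_add₀ hz0,
        ← zpow_add₀ hz0]
      congr 2
      omega
    · rw [finrank_span_eq_card hli, (graphGr _).2, Fintype.card_fin]

end Limits


/-! ### Convergence in finite-dimensional spaces without a chosen topology -/

section FinTendsto

variable {α : Type*} {l : Filter α} {W X : Type*} [AddCommMonoid W] [Module ℂ W]
  [AddCommMonoid X] [Module ℂ X]

/-- Convergence tested on all linear functionals. -/
def FinTendsto (l : Filter α) (f : α → W) (x : W) : Prop :=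
  ∀ φ : Module.Dual ℂ W, Tendsto (fun a => φ (f a)) l (𝓝 (φ x))

theorem FinTendsto.map {f : α → W} {x : W} (h : FinTendsto l f x) (T : W →ₗ[ℂ] X) :
    FinTendsto l (fun a => T (f a)) (T x) := fun φ => h (φ ∘ₗ T)

theorem FinTendsto.congr' {f g : α → W} {x : W} (h : FinTendsto l f x) (hfg : f =ᶠ[l] g) :
    FinTendsto l g x := fun φ =>
  (h φ).congr' (hfg.mono fun a ha => by rw [ha])

theorem FinTendsto.smul_const {c : α → ℂ} {c₀ : ℂ} (h : Tendsto c l (𝓝 c₀)) (x : W) :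
    FinTendsto l (fun a => c a • x) (c₀ • x) := fun φ => by
  simp only [map_smul]
  exact h.smul_const _

theorem FinTendsto.of_basis {ι : Type*} [Fintype ι] (b : Module.Basis ι ℂ W) {f : α → W} {x : W}
    (h : ∀ i, Tendsto (fun a => b.repr (f a) i) l (𝓝 (b.repr x i))) : FinTendsto l f x := by
  intro φ
  have key : ∀ y, φ y = ∑ i, b.repr y i * φ (b i) := fun y => by
    conv_lhs => rw [← b.sum_repr y]
    simp only [map_sum, map_smul, smul_eq_mul]
  rw [funext fun a => key (f a), key x]
  exact tendsto_finsetSum _ fun i _ => (h i).mul_const _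

/-- An operator is the sum of b_i^* ⊗ S(b_i), so a functional of S is a sum of functionals of the
values S(b_i). -/
theorem FinTendsto.end_of_basis {ι : Type*} [Fintype ι] (b : Module.Basis ι ℂ W)
    {T : α → Module.End ℂ W} {T₀ : Module.End ℂ W}
    (h : ∀ i, FinTendsto l (fun a => T a (b i)) (T₀ (b i))) : FinTendsto l T T₀ := by
  intro φ
  have key : ∀ S : Module.End ℂ W,
      φ S = ∑ i, (φ ∘ₗ LinearMap.smulRightₗ (b.coord i)) (S (b i)) := by
    intro S
    simp only [LinearMap.comp_apply]
    rw [← map_sum]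
    congr 1
    refine b.ext fun j => ?_
    classical
    simp [LinearMap.sum_apply, Finsupp.single_apply, ite_smul, Finset.sum_ite_eq]
  rw [funext fun a => key (T a), key T₀]
  exact tendsto_finsetSum _ fun i _ => h i _

theorem FinTendsto.multilinear {ι : Type*} [Fintype ι] {Y : ι → Type*}
    [∀ i, AddCommMonoid (Y i)] [∀ i, Module ℂ (Y i)] [∀ i, Module.Finite ℂ (Y i)]
    (M : MultilinearMap ℂ Y W) {f : α → ∀ i, Y i} {x : ∀ i, Y i}
    (h : ∀ i, FinTendsto l (fun a => f a i) (x i)) : FinTendsto l (fun a => M (f a)) (M x) := by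
  classical
  intro φ
  let _ : ∀ i, AddCommGroup (Y i) := fun i => Module.addCommMonoidToAddCommGroup ℂ
  let b := fun i => Module.finBasis ℂ (Y i)
  have key : ∀ y : ∀ i, Y i, φ (M y) = ∑ r : (∀ i, Fin (Module.finrank ℂ (Y i))),
      (∏ i, (b i).coord (r i) (y i)) * φ (M fun i => b i (r i)) := by
    intro y
    have hy : y = fun i => ∑ j, (b i).coord j (y i) • b i j := by
      funext i
      exact ((b i).sum_repr (y i)).symm
    conv_lhs => rw [hy]
    rw [M.map_sum, map_sum]
    refine Finset.sum_congr rfl fun r _ => ?_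
    rw [M.map_smul_univ, map_smul, smul_eq_mul]
  rw [funext fun a => key (f a), key x]
  exact tendsto_finsetSum _ fun r _ =>
    (tendsto_finsetProd _ fun i _ => h i ((b i).coord (r i))).mul_const _

theorem FinTendsto.mul_mul {U : Type*} [AddCommGroup U] [Module ℂ U] [Module.Finite ℂ U]
    {f g h : α → Module.End ℂ U} {f₀ g₀ h₀ : Module.End ℂ U} (hf : FinTendsto l f f₀) (hg : FinTendsto l g g₀)
    (hh : FinTendsto l h h₀) : FinTendsto l (fun a => f a * g a * h a) (f₀ * g₀ * h₀) := by
  have := FinTendsto.multilinear (MultilinearMap.mkPiAlgebraFin ℂ 3 (Module.End ℂ U))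
    (f := fun a => ![f a, g a, h a]) (x := ![f₀, g₀, h₀]) (l := l)
    (fun i => by fin_cases i; exacts [hf, hg, hh])
  simpa [MultilinearMap.mkPiAlgebraFin_apply, mul_assoc] using this

/-- Subspaces are closed: a functional vanishing on N but not at x would contradict convergence. -/
theorem FinTendsto.mem_of_eventually_mem [l.NeBot] {f : α → W} {x : W} (h : FinTendsto l f x)
    {N : Submodule ℂ W} (hN : ∀ᶠ a in l, f a ∈ N) : x ∈ N := by
  by_contra hx
  let _ : AddCommGroup W := Module.addCommMonoidToAddCommGroup ℂ
  obtain ⟨φ, hφ, hφN⟩ := N.exists_dual_map_eq_bot_of_notMem hx inferInstance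
  refine hφ ?_
  refine tendsto_nhds_unique (h φ) (tendsto_const_nhds.congr' ?_)
  filter_upwards [hN] with a ha
  have : φ (f a) ∈ N.map φ := Submodule.mem_map_of_mem ha
  rw [hφN, Submodule.mem_bot] at this
  exact this.symm

theorem FinTendsto.tendsto_moduleTopology [Module.Finite ℂ W] {f : α → W} {x : W}
    (h : FinTendsto l f x) : Tendsto f l (@nhds W (moduleTopology ℂ W) x) := by
  let _ : AddCommGroup W := Module.addCommMonoidToAddCommGroup ℂ
  let : TopologicalSpace W := moduleTopology ℂ W
  have : ContinuousAdd W := ModuleTopology.continuousAdd ℂ W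
  have : ContinuousSMul ℂ W := ModuleTopology.continuousSMul ℂ W
  let b := Module.finBasis ℂ W
  have key : ∀ y, ∑ i, b.coord i y • b i = y := fun y => b.sum_repr y
  have : Tendsto (fun a => ∑ i, b.coord i (f a) • b i) l (𝓝 (∑ i, b.coord i x • b i)) :=
    tendsto_finsetSum _ fun i _ => (h (b.coord i)).smul_const _
  simpa only [key] using this

end FinTendsto

/-! ### Sums of exponents -/

section Weights

variable {n : ℕ}

/-- The sum of the first `d` exponents. -/
def topSum (m : Fin n → ℤ) (d : ℕ) : ℤ := ∑ i ∈ Finset.univ.filter (fun i : Fin n => i.val < d), m i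

theorem sum_sub_le (m : Fin n → ℤ) (k : ℤ) (I : Finset (Fin n)) :
    ∑ i ∈ I, (m i - k) ≤ ∑ i, max (m i - k) 0 := by
  classical
  rw [← Finset.univ_inter I, ← Finset.sum_ite_mem]
  refine Finset.sum_le_sum fun i _ => ?_
  split_ifs
  · exact le_max_left _ _
  · exact le_max_right _ _

/-- Equality must hold term by term: positive terms cannot be omitted and negative ones cannot be
included. Shifting by k, like a Lagrange multiplier, replaces maximization over sets of fixed size
by this unconstrained one. -/
theorem sum_sub_eq_iff (m : Fin n → ℤ) (k : ℤ) (I : Finset (Fin n)) :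
    ∑ i ∈ I, (m i - k) = ∑ i, max (m i - k) 0 ↔
      (∀ i, k < m i → i ∈ I) ∧ ∀ i ∈ I, k ≤ m i := by
  classical
  rw [← Finset.univ_inter I, ← Finset.sum_ite_mem, Finset.univ_inter, Finset.sum_eq_sum_iff_of_le]
  · constructor
    · intro h
      refine ⟨fun i hi => ?_, fun i hi => ?_⟩
      · by_contra hI
        have := h i (Finset.mem_univ _)
        rw [if_neg hI] at this
        omega
      · have := h i (Finset.mem_univ _)
        rw [if_pos hi] at this
        omega
    · rintro ⟨h1, h2⟩ i _
      split_ifs with hI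
      · have := h2 i hI
        omega
      · have : ¬ k < m i := fun h => hI (h1 i h)
        omega
  · intro i _
    split_ifs
    · exact le_max_left _ _
    · exact le_max_right _ _

theorem topSum_eq {m : Fin n → ℤ} (hm : Antitone m) {k : ℤ} {d : ℕ} (hp : numGt m k ≤ d)
    (hq : d ≤ numGe m k) : topSum m d = ∑ i, max (m i - k) 0 + d * k := by
  have hd : d ≤ n := hq.trans (numGe_le m k)
  rw [← (sum_sub_eq_iff m k (Finset.univ.filter fun i : Fin n => i.val < d)).2]
  · rw [Finset.sum_sub_distrib, Finset.sum_const, card_val_lt hd, nsmul_eq_mul, topSum]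
    ring
  · refine ⟨fun i hi => ?_, fun i hi => ?_⟩
    · have := (lt_numGt_iff hm).2 hi
      simp only [Finset.mem_filter, Finset.mem_univ, true_and]
      omega
    · simp only [Finset.mem_filter, Finset.mem_univ, true_and] at hi
      exact (lt_numGe_iff hm).1 (by omega)

theorem sum_eq_sum_sub (m : Fin n → ℤ) (k : ℤ) (I : Finset (Fin n)) :
    ∑ i ∈ I, m i = ∑ i ∈ I, (m i - k) + I.card * k := by
  rw [Finset.sum_sub_distrib, Finset.sum_const, nsmul_eq_mul]
  ring

theorem sum_le_topSum {m : Fin n → ℤ} (hm : Antitone m) {k : ℤ} {I : Finset (Fin n)}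
    (hp : numGt m k ≤ I.card) (hq : I.card ≤ numGe m k) : ∑ i ∈ I, m i ≤ topSum m I.card := by
  rw [topSum_eq hm hp hq, sum_eq_sum_sub m k]
  have := sum_sub_le m k I
  omega

/-- The weight of the limit of `z^{topSum m d} Λ^d(diag(z^{-m}))`. -/
def maxWeight (m : Fin n → ℤ) (I : Finset (Fin n)) : ℂ :=
  if ∑ i ∈ I, m i = topSum m I.card then 1 else 0

/-- The bridge between hinge and limit: the sets selected by λ(P_j) are those that maximize the sum
of exponents among sets of the same size. -/
theorem lamWeight_eq_maxWeight {m : Fin n → ℤ} (hm : Antitone m) {k : ℤ} {I : Finset (Fin n)}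
    (hp : numGt m k ≤ I.card) (hq : I.card ≤ numGe m k) :
    lamWeight (numGt m k) (numGe m k) I = maxWeight m I := by
  unfold lamWeight maxWeight
  have : (∑ i ∈ I, m i = topSum m I.card) ↔
      (∀ i : Fin n, i.val < numGt m k → i ∈ I) ∧ ∀ i ∈ I, i.val < numGe m k := by
    rw [topSum_eq hm hp hq, sum_eq_sum_sub m k, add_left_inj, sum_sub_eq_iff]
    simp only [lt_numGt_iff hm, lt_numGe_iff hm]
  simp only [this]

/-- `ν`, extended by zero. -/
def extendZero (ν : Fin n → ℕ) (j : ℕ) : ℕ := if h : j < n then ν ⟨j, h⟩ else 0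

theorem sum_drop {ν : Fin n → ℕ} (hν : Antitone ν) (i : Fin n) :
    ∑ j : Fin n, (if i.val < j.val + 1 then (drop ν j : ℤ) else 0) = ν i := by
  have hdrop : ∀ j : Fin n,
      (drop ν j : ℤ) = (extendZero ν j.val : ℤ) - extendZero ν (j.val + 1) := by
    intro j
    have h1 : extendZero ν j.val = ν j := by simp [extendZero]
    have h2 : extendZero ν (j.val + 1) ≤ ν j := by
      unfold extendZero
      split_ifs with h
      · exact hν (by simp [Fin.le_def])
      · exact Nat.zero_le _
    have h3 : drop ν j = ν j - extendZero ν (j.val + 1) := rfl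
    rw [h1, h3]
    omega
  simp only [hdrop]
  have key : ∀ N, i.val ≤ N → ∑ j ∈ Finset.range N, (if i.val < j + 1 then
      (extendZero ν j : ℤ) - extendZero ν (j + 1) else 0) =
        extendZero ν i.val - extendZero ν N := by
    intro N hN
    induction N, hN using Nat.le_induction with
    | base =>
      rw [sub_self]
      refine Finset.sum_eq_zero fun j hj => if_neg ?_
      have := Finset.mem_range.1 hj
      omega
    | succ N hN ih =>
      rw [Finset.sum_range_succ, ih, if_pos (by omega)]
      ring
  rw [Fin.sum_univ_eq_sum_range (fun j => if i.val < j + 1 then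
      (extendZero ν j : ℤ) - extendZero ν (j + 1) else 0) n, key n i.2.le]
  simp [extendZero]

/-- Abel summation. It explains the normalizing power in the lemma: each tensor factor of degree d
contributes the sum of the d first exponents. -/
theorem sum_factors_topSum {ν : Fin n → ℕ} (hν : Antitone ν) (m : Fin n → ℤ) :
    ∑ x : Factors ν, topSum m (x.1.val + 1) = ∑ i, m i * (ν i : ℤ) := by
  rw [Fintype.sum_sigma]
  simp only [Finset.sum_const, Finset.card_univ, Fintype.card_fin, nsmul_eq_mul]
  have h1 : ∀ j : Fin n, (drop ν j : ℤ) * topSum m (j.val + 1) =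
      ∑ i, m i * (if i.val < j.val + 1 then (drop ν j : ℤ) else 0) := by
    intro j
    rw [topSum, Finset.sum_filter, Finset.mul_sum]
    refine Finset.sum_congr rfl fun i _ => ?_
    split_ifs
    · ring
    · simp
  rw [Finset.sum_congr rfl fun j _ => h1 j, Finset.sum_comm]
  refine Finset.sum_congr rfl fun i _ => ?_
  rw [← Finset.mul_sum, sum_drop hν]

end Weights


/-! ### Limits of operators in exterior powers -/

section ExteriorLimits

variable {n : ℕ}

theorem lamCha_comp (A B : V n →ₗ[ℂ] V n) (d : ℕ) :
    lamCha (A ∘ₗ B) d = lamCha A d * lamCha B d :=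
  exteriorPower.map_comp B A

theorem lamCha_ιMulti (A : V n →ₗ[ℂ] V n) {d : ℕ} (v : Fin d → V n) :
    lamCha A d (exteriorPower.ιMulti ℂ d v) = exteriorPower.ιMulti ℂ d (A ∘ v) :=
  exteriorPower.map_apply_ιMulti A v

theorem finTendsto_lamCha {a : ℂ → Matrix (Fin n) (Fin n) ℂ} (ha : IsHolomorphicGL a) (d : ℕ) :
    FinTendsto (𝓝[≠] (0 : ℂ)) (fun z => lamCha (a z).toLin' d) (lamCha (a 0).toLin' d) := by
  refine FinTendsto.end_of_basis ((Pi.basisFun ℂ (Fin n)).exteriorPower d) fun t => ?_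
  rw [exteriorPower.basis_apply, exteriorPower.ιMulti_family]
  simp only [lamCha_ιMulti]
  refine FinTendsto.multilinear (exteriorPower.ιMulti ℂ d (M := V n)).toMultilinearMap fun j => ?_
  refine FinTendsto.of_basis (Pi.basisFun ℂ (Fin n)) fun i => ?_
  simpa using ((ha.1 i _).continuousAt.tendsto.mono_left nhdsWithin_le_nhds)

theorem tendsto_zpow_of_nonneg {k : ℤ} (hk : 0 ≤ k) :
    Tendsto (fun z : ℂ => z ^ k) (𝓝[≠] 0) (𝓝 (if k = 0 then 1 else 0)) := by
  obtain ⟨N, rfl⟩ := Int.eq_ofNat_of_zero_le hk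
  simp only [zpow_natCast, Nat.cast_eq_zero]
  have : (if N = 0 then 1 else 0 : ℂ) = (0 : ℂ) ^ N := by
    split_ifs with h
    · simp [h]
    · simp [h]
  rw [this]
  exact ((continuous_pow N).tendsto (0 : ℂ)).mono_left nhdsWithin_le_nhds

theorem finTendsto_coordOp (e E : Module.Basis (Fin n) ℂ (V n)) {d : ℕ} {α : Type*}
    {l : Filter α} {φ : α → Finset (Fin n) → ℂ} {φ₀ : Finset (Fin n) → ℂ}
    (h : ∀ I, I.card = d → Tendsto (fun a => φ a I) l (𝓝 (φ₀ I))) :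
    FinTendsto l (fun a => coordOp e E (φ a) d) (coordOp e E φ₀ d) := by
  refine FinTendsto.end_of_basis (e.exteriorPower d) fun t => ?_
  simp only [coordOp, Module.Basis.constr_basis]
  exact FinTendsto.smul_const (h _ t.2) _

theorem smul_lamCha_diagonal (m : Fin n → ℤ) {z : ℂ} (hz : z ≠ 0) (d : ℕ) :
    z ^ topSum m d • lamCha (Matrix.diagonal fun i => z ^ (-m i)).toLin' d =
      coordOp (Pi.basisFun ℂ (Fin n)) (Pi.basisFun ℂ (Fin n))
        (fun I => z ^ (topSum m I.card - ∑ i ∈ I, m i)) d := by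
  refine exterior_ext (Pi.basisFun ℂ (Fin n)) fun s => ?_
  rw [coordOp_ιMulti, LinearMap.smul_apply, lamCha_ιMulti]
  by_cases hs : Function.Injective s
  · have h1 : (Matrix.diagonal fun i => z ^ (-m i)).toLin' ∘ (Pi.basisFun ℂ (Fin n) ∘ s) =
        fun j => z ^ (-m (s j)) • (Pi.basisFun ℂ (Fin n) ∘ s) j := by
      funext j
      simp only [Function.comp_apply, Pi.basisFun_apply, Matrix.toLin'_apply,
        Matrix.diagonal_mulVec_single, mul_one]
      rw [← Pi.single_smul, smul_eq_mul, mul_one]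
    have hcard : (Finset.univ.image s).card = d := by
      rw [Finset.card_image_of_injective _ hs]
      simp
    have h2 : ∏ j, z ^ (-m (s j)) = z ^ (-∑ i ∈ Finset.univ.image s, m i) := by
      rw [Finset.sum_image hs.injOn, ← Finset.sum_neg_distrib]
      -- Integer powers of z ≠ 0 form a homomorphism from ℤ to ℂˣ, which turns the sum into the
      -- product.
      have := map_sum (zmultiplesHom (Additive ℂˣ) (Additive.ofMul (Units.mk0 z hz)))
        (fun j => -m (s j)) Finset.univ
      have h3 := congrArg (fun x : Additive ℂˣ => ((Additive.toMul x : ℂˣ) : ℂ)) this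
      simpa [toMul_sum] using h3.symm
    rw [h1, AlternatingMap.map_smul_univ, h2, smul_smul, ← zpow_add₀ hz, hcard, sub_eq_add_neg]
  · have hs' : ¬ Function.Injective
        ((Matrix.diagonal fun i => z ^ (-m i)).toLin' ∘ (Pi.basisFun ℂ (Fin n) ∘ s)) :=
      fun h => hs h.of_comp.of_comp
    rw [ιMulti_comp_of_not_injective _ hs, AlternatingMap.map_eq_zero_of_not_injective _ _ hs',
      smul_zero, smul_zero]

/-- By `hle` the normalized diagonal factor has only nonnegative powers of z, and its limit keeps
the sets of maximal sum. The outer factors converge to Λ^d a(0) and Λ^d b(0), which change the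
standard basis into `E` and `e` into the standard basis. -/
theorem finTendsto_smul_lamCha {γ a b : ℂ → Matrix (Fin n) (Fin n) ℂ} {m : Fin n → ℤ}
    (ha : IsHolomorphicGL a) (hb : IsHolomorphicGL b)
    (hγ : ∀ᶠ z in 𝓝[≠] (0 : ℂ), γ z = a z * Matrix.diagonal (fun i => z ^ (-m i)) * b z)
    (hle : ∀ I : Finset (Fin n), ∑ i ∈ I, m i ≤ topSum m I.card)
    (hb' : IsUnit (b 0)⁻¹) (d : ℕ) :
    FinTendsto (𝓝[≠] (0 : ℂ)) (fun z => z ^ topSum m d • lamCha (γ z).toLin' d)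
      (coordOp (colBasis (b 0)⁻¹ hb') (colBasis (a 0) ha.2) (maxWeight m) d) := by
  let e := Pi.basisFun ℂ (Fin n)
  have hlim : FinTendsto (𝓝[≠] (0 : ℂ))
      (fun z => coordOp e e (fun I => z ^ (topSum m I.card - ∑ i ∈ I, m i)) d)
      (coordOp e e (maxWeight m) d) := by
    refine finTendsto_coordOp e e fun I _ => ?_
    have := tendsto_zpow_of_nonneg (sub_nonneg.2 (hle I))
    have hiff : topSum m I.card - ∑ i ∈ I, m i = 0 ↔ ∑ i ∈ I, m i = topSum m I.card := by
      rw [sub_eq_zero, eq_comm]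
    simpa only [maxWeight, hiff] using this
  have h := ((finTendsto_lamCha ha d).mul_mul hlim (finTendsto_lamCha hb d)).congr' (g := fun z =>
    z ^ topSum m d • lamCha (γ z).toLin' d) (by
      filter_upwards [hγ, self_mem_nhdsWithin] with z hz hz0
      rw [← smul_lamCha_diagonal m hz0 d, hz, Matrix.toLin'_mul, Matrix.toLin'_mul, lamCha_comp,
        lamCha_comp, mul_smul_comm, smul_mul_assoc])
  convert h using 1
  refine exterior_ext (colBasis (b 0)⁻¹ hb') fun s => ?_
  have hbdet := (Matrix.isUnit_iff_isUnit_det _).1 hb.2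
  have hbe : (b 0).toLin' ∘ (colBasis (b 0)⁻¹ hb' ∘ s) = e ∘ s := by
    funext j
    simp only [Function.comp_apply, colBasis_apply]
    rw [← LinearMap.comp_apply, ← Matrix.toLin'_mul, Matrix.mul_nonsing_inv _ hbdet,
      Matrix.toLin'_one]
    simp [e]
  have hae : (a 0).toLin' ∘ (e ∘ s) = colBasis (a 0) ha.2 ∘ s := by
    funext j
    simp only [Function.comp_apply, colBasis_apply]
    simp [e]
  rw [coordOp_ιMulti, Module.End.mul_apply, Module.End.mul_apply, lamCha_ιMulti, hbe,
    coordOp_ιMulti, map_smul, lamCha_ιMulti, hae]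

end ExteriorLimits

/-! ### The representations -/

section Representation

variable {n : ℕ} {ν : Fin n → ℕ}

theorem bigRho_tprod (A : ExtOps n) (x : ∀ y : Factors ν, ⋀[ℂ]^(y.1.val + 1) (V n)) :
    bigRho ν A (PiTensorProduct.tprod ℂ x) =
      PiTensorProduct.tprod ℂ (fun y : Factors ν => A (y.1.val + 1) (x y)) :=
  PiTensorProduct.map_tprod (fun y : Factors ν => A (y.1.val + 1)) x

theorem bigRho_mul (A B : ExtOps n) :
    bigRho ν (fun d => A d * B d) = bigRho ν A * bigRho ν B :=
  PiTensorProduct.map_mul _ _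

theorem bigRho_congr {A B : ExtOps n} (h : ∀ d ≤ n, A d = B d) : bigRho ν A = bigRho ν B := by
  unfold bigRho
  congr 1
  funext x
  exact h _ x.1.isLt

theorem bigRho_smul (c : ℕ → ℂ) (A : ExtOps n) :
    bigRho ν (fun d => c d • A d) = (∏ x : Factors ν, c (x.1.val + 1)) • bigRho ν A :=
  (PiTensorProduct.mapMultilinear ℂ (fun x : Factors ν => ⋀[ℂ]^(x.1.val + 1) (V n))
    (fun x : Factors ν => ⋀[ℂ]^(x.1.val + 1) (V n))).map_smul_univ
      (fun x => c (x.1.val + 1)) (fun x => A (x.1.val + 1))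

theorem finTendsto_bigRho {α : Type*} {l : Filter α} {A : α → ExtOps n} {A₀ : ExtOps n}
    (h : ∀ d, FinTendsto l (fun a => A a d) (A₀ d)) :
    FinTendsto l (fun a => bigRho ν (A a)) (bigRho ν A₀) := by
  have key : ∀ B : ExtOps n, bigRho ν B =
      PiTensorProduct.mapMultilinear ℂ (fun x : Factors ν => ⋀[ℂ]^(x.1.val + 1) (V n))
        (fun x : Factors ν => ⋀[ℂ]^(x.1.val + 1) (V n)) (fun x => B (x.1.val + 1)) :=
    fun _ => rfl
  simp only [key]
  exact FinTendsto.multilinear (Y := fun x : Factors ν => Module.End ℂ (⋀[ℂ]^(x.1.val + 1) (V n)))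
    (PiTensorProduct.mapMultilinear ℂ (fun x : Factors ν => ⋀[ℂ]^(x.1.val + 1) (V n))
      (fun x : Factors ν => ⋀[ℂ]^(x.1.val + 1) (V n)))
    (f := fun a x => A a (x.1.val + 1)) (x := fun x => A₀ (x.1.val + 1)) (fun x => h _)

theorem tprod_ne_zero {ι : Type*} [Fintype ι] {Y : ι → Type*} [∀ i, AddCommMonoid (Y i)]
    [∀ i, Module ℂ (Y i)] {x : ∀ i, Y i} (hx : ∀ i, x i ≠ 0) :
    PiTensorProduct.tprod ℂ x ≠ 0 := by
  have h : ∀ i, ∃ φ : Module.Dual ℂ (Y i), φ (x i) ≠ 0 := fun i => by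
    by_contra! hcon
    let _ : AddCommGroup (Y i) := Module.addCommMonoidToAddCommGroup ℂ
    exact hx i ((Module.forall_dual_apply_eq_zero_iff ℂ _).1 hcon)
  choose φ hφ using h
  intro hzero
  have := congrArg (PiTensorProduct.lift
    ((MultilinearMap.mkPiAlgebra ℂ ι ℂ).compLinearMap φ)) hzero
  rw [PiTensorProduct.lift.tprod, map_zero, MultilinearMap.compLinearMap_apply,
    MultilinearMap.mkPiAlgebra_apply] at this
  exact Finset.prod_ne_zero_iff.2 (fun i _ => hφ i) this

theorem bigRho_mem_H (g : V n ≃ₗ[ℂ] V n) {x : BigH ν} (hx : x ∈ H ν) :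
    bigRho ν (lamCha (g : V n →ₗ[ℂ] V n)) x ∈ H ν := by
  unfold H at hx
  induction hx using Submodule.span_induction with
  | mem x hx =>
    obtain ⟨h, rfl⟩ := hx
    refine Submodule.subset_span ⟨h.trans g, ?_⟩
    dsimp only
    rw [← Module.End.mul_apply, ← bigRho_mul]
    congr 2
    funext d
    exact lamCha_comp _ _ d
  | zero => rw [map_zero]; exact zero_mem _
  | add x y _ _ hx hy => rw [map_add]; exact add_mem hx hy
  | smul c x _ hx => rw [map_smul]; exact Submodule.smul_mem _ _ hx

theorem bigRho_matrix_mem_H {a : Matrix (Fin n) (Fin n) ℂ} (ha : IsUnit a) {x : BigH ν}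
    (hx : x ∈ H ν) : bigRho ν (lamCha a.toLin') x ∈ H ν := by
  have hdet := (Matrix.isUnit_iff_isUnit_det a).1 ha
  exact bigRho_mem_H (Matrix.toLin'OfInv (Matrix.nonsing_inv_mul a hdet)
    (Matrix.mul_nonsing_inv a hdet)) hx

theorem bigXi_mem_H : bigXi ν ∈ H ν := by
  refine Submodule.subset_span ⟨LinearEquiv.refl ℂ _, ?_⟩
  have : lamCha ((LinearEquiv.refl ℂ (V n) : V n ≃ₗ[ℂ] V n) : V n →ₗ[ℂ] V n) =
      fun d => LinearMap.id := by
    funext d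
    exact exteriorPower.map_id
  dsimp only
  rw [this, bigXi, bigRho_tprod]
  rfl

theorem rho_apply_of_invariant {A : ExtOps n} (h : ∀ x ∈ H ν, bigRho ν A x ∈ H ν) :
    rho ν A = (bigRho ν A).restrict h := dif_pos h

theorem rho_congr {A B : ExtOps n} (h : bigRho ν A = bigRho ν B) : rho ν A = rho ν B := by
  classical
  exact congrArg (fun f : Module.End ℂ (BigH ν) =>
    if h : ∀ x ∈ H ν, f x ∈ H ν then f.restrict h else 0) h

/-- A linear extension to all operators of the restriction of operators to `H_ν`. -/
theorem exists_restrictLinear (ν : Fin n → ℕ) :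
    ∃ R : Module.End ℂ (BigH ν) →ₗ[ℂ] Module.End ℂ (H ν),
      ∀ (f : Module.End ℂ (BigH ν)) (h : ∀ x ∈ H ν, f x ∈ H ν), R f = f.restrict h := by
  let _ : AddCommGroup (BigH ν) := Module.addCommMonoidToAddCommGroup ℂ
  -- Compressing by a projection onto H_ν is linear in the operator and agrees with restriction
  -- whenever H_ν is invariant, so convergence passes to restrictions.
  obtain ⟨π, hπ⟩ := (H ν).subtype.exists_leftInverse_of_injective (Submodule.ker_subtype _)
  refine ⟨(LinearMap.lcomp ℂ (H ν) (H ν).subtype) ∘ₗ (LinearMap.llcomp ℂ (BigH ν) (BigH ν) (H ν) π),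
    fun f h => LinearMap.ext fun x => ?_⟩
  exact LinearMap.congr_fun hπ ⟨f x, h x x.2⟩

theorem finTendsto_smul_bigRho {γ : ℂ → Matrix (Fin n) (Fin n) ℂ} {m : Fin n → ℤ}
    (hν : Antitone ν) {L : ExtOps n}
    (hL : ∀ d, FinTendsto (𝓝[≠] (0 : ℂ)) (fun z => z ^ topSum m d • lamCha (γ z).toLin' d) (L d)) :
    FinTendsto (𝓝[≠] (0 : ℂ))
      (fun z => z ^ (∑ i, m i * (ν i : ℤ)) • bigRho ν (lamCha (γ z).toLin')) (bigRho ν L) := by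
  refine (finTendsto_bigRho hL).congr' ?_
  filter_upwards [self_mem_nhdsWithin] with z hz
  rw [bigRho_smul, ← sum_factors_topSum hν m]
  congr 1
  have h2 : ∀ s : Finset (Factors ν), ∏ x ∈ s, z ^ topSum m (x.1.val + 1) =
      z ^ ∑ x ∈ s, topSum m (x.1.val + 1) := by
    classical
    intro s
    induction s using Finset.induction_on with
    | empty => simp
    | insert x s hx ih => rw [Finset.prod_insert hx, Finset.sum_insert hx, ih, zpow_add₀ hz]
  exact h2 _

theorem opTendsto_rho {γ : ℂ → Matrix (Fin n) (Fin n) ℂ} {m : Fin n → ℤ} (hν : Antitone ν)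
    (hunit : ∀ᶠ z in 𝓝[≠] (0 : ℂ), IsUnit (γ z)) {L : ExtOps n}
    (hL : ∀ d, FinTendsto (𝓝[≠] (0 : ℂ)) (fun z => z ^ topSum m d • lamCha (γ z).toLin' d) (L d)) :
    (∀ x ∈ H ν, bigRho ν L x ∈ H ν) ∧
      OpTendsto ν (fun z => z ^ (∑ i, m i * (ν i : ℤ)) • rho ν (lamCha (γ z).toLin')) (rho ν L) := by
  have hlim := finTendsto_smul_bigRho hν hL
  have hinv : ∀ x ∈ H ν, bigRho ν L x ∈ H ν := by
    intro x hx
    refine (hlim.map (LinearMap.applyₗ x)).mem_of_eventually_mem ?_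
    filter_upwards [hunit] with z hz
    exact Submodule.smul_mem _ _ (bigRho_matrix_mem_H hz hx)
  refine ⟨hinv, ?_⟩
  obtain ⟨R, hR⟩ := exists_restrictLinear ν
  rw [rho_apply_of_invariant hinv, ← hR]
  have hfin : Module.Finite ℂ (Module.End ℂ (H ν)) := by
    let _ : AddCommGroup (BigH ν) := Module.addCommMonoidToAddCommGroup ℂ
    infer_instance
  refine ((hlim.map R).congr' ?_).tendsto_moduleTopology
  filter_upwards [hunit] with z hz
  rw [map_smul, rho_apply_of_invariant fun x hx => bigRho_matrix_mem_H hz hx, ← hR]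

theorem coordOp_maxWeight_xi_ne_zero {a : Matrix (Fin n) (Fin n) ℂ} (ha : IsUnit a)
    (E : Module.Basis (Fin n) ℂ (V n)) (m : Fin n → ℤ) {d : ℕ} (hd : d ≤ n) :
    coordOp (colBasis a ha) E (maxWeight m) d (lamCha a.toLin' d (xi d hd)) ≠ 0 := by
  have hxi : lamCha a.toLin' d (xi d hd) =
      exteriorPower.ιMulti ℂ _ (colBasis a ha ∘ Fin.castLE hd) := by
    rw [xi, lamCha_ιMulti]
    congr 1
    funext j
    simp only [Function.comp_apply, colBasis_apply]
  have hweight : maxWeight m (Finset.univ.image (Fin.castLE hd)) = 1 := by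
    unfold maxWeight
    rw [if_pos]
    unfold topSum
    congr 1
    rw [Finset.card_image_of_injective _ (Fin.castLE_injective hd), Finset.card_univ,
      Fintype.card_fin]
    ext i
    simp only [Finset.mem_image, Finset.mem_univ, true_and, Finset.mem_filter]
    constructor
    · rintro ⟨j, rfl⟩
      exact j.2
    · intro hi
      exact ⟨⟨i, hi⟩, rfl⟩
  rw [hxi, coordOp_ιMulti, hweight, one_smul]
  exact ιMulti_comp_ne_zero E (Fin.castLE_injective hd)

/-- The witness is the image of Ξ_ν under a: each of its factors e_1 ∧ ⋯ ∧ e_d, in the column basis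
of a, has a maximal index set and goes to E_1 ∧ ⋯ ∧ E_d. -/
theorem rho_coordOp_maxWeight_ne_zero {a : Matrix (Fin n) (Fin n) ℂ} (ha : IsUnit a)
    (E : Module.Basis (Fin n) ℂ (V n)) (m : Fin n → ℤ)
    (hinv : ∀ x ∈ H ν, bigRho ν (coordOp (colBasis a ha) E (maxWeight m)) x ∈ H ν) :
    rho ν (coordOp (colBasis a ha) E (maxWeight m)) ≠ 0 := by
  intro hzero
  rw [rho_apply_of_invariant hinv] at hzero
  have hx := bigRho_matrix_mem_H ha (bigXi_mem_H (ν := ν))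
  have h1 : bigRho ν (coordOp (colBasis a ha) E (maxWeight m))
      (bigRho ν (lamCha a.toLin') (bigXi ν)) = 0 :=
    congrArg Subtype.val (LinearMap.congr_fun hzero ⟨_, hx⟩)
  rw [bigXi, bigRho_tprod, bigRho_tprod] at h1
  exact tprod_ne_zero (fun y : Factors ν => coordOp_maxWeight_xi_ne_zero ha E m y.1.isLt) h1

end Representation

end Urchin

end

/-! ### Comparison of the two limits -/

open Urchin in
theorem lemma3p4 {n : ℕ} (hn : 0 < n) (ν : Fin n → ℕ) (hν : Antitone ν)
    (γ : ℂ → Matrix (Fin n) (Fin n) ℂ) (hγ : Urchin.IsMeromorphicFamily γ) :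
    (∃ m : Fin n → ℤ, Urchin.IsExponents γ m) ∧
    ∀ m : Fin n → ℤ, Urchin.IsExponents γ m →
      ∃ T₀ : Module.End ℂ (Urchin.H ν), T₀ ≠ 0 ∧
        Urchin.OpTendsto ν
          (fun z => z ^ (∑ i, m i * (ν i : ℤ)) • Urchin.rho ν (Urchin.lamCha (γ z).toLin')) T₀ ∧
        ∃ P : Fin (Urchin.numExp m) → Urchin.Gr n,
          Urchin.IsLimitFamily γ m P ∧ Urchin.IsHinge P ∧
          (∃ L : Urchin.ExtOps n, Urchin.IsCanonicalCollection P L) ∧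
          ∀ L : Urchin.ExtOps n, Urchin.IsCanonicalCollection P L → T₀ = Urchin.rho ν L := by
  refine ⟨exists_isExponents hγ, fun m hm => ?_⟩
  obtain ⟨hanti, a, b, ha, hb, hfac⟩ := hm
  have hb' : IsUnit (b 0)⁻¹ := Matrix.isUnit_nonsing_inv_iff.2 hb.2
  let e := colBasis (b 0)⁻¹ hb'
  let E := colBasis (a 0) ha.2
  let p : Fin (numExp m) → ℕ := fun j => numGt m (distinctExp m j)
  let q : Fin (numExp m) → ℕ := fun j => numGe m (distinctExp m j)
  let P : Fin (numExp m) → Gr n := fun j => ⟨stdRel e E (p j) (q j), by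
    rw [← stdRel_eq_span_pair e E (numGt_le_numGe m _) (α := fun i => if i.val < p j then 0 else 1)
      (β := fun i => if i.val < q j then 1 else 0) (fun _ => rfl) (fun _ => rfl),
      finrank_span_eq_card, Fintype.card_fin]
    refine linearIndependent_pair e E _ _ fun i => ?_
    have hpq : p j ≤ q j := numGt_le_numGe m _
    by_cases h : i.val < q j
    · right; simp [h]
    · left; simp only [if_neg (show ¬ i.val < p j by omega)]; exact one_ne_zero⟩
  have hadapted : IsAdapted e E p q P :=
    { pos := numExp_pos hn m
      lt := numGt_lt_numGe m
      le := fun j => numGe_le m _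
      succ := fun i j hij => numGe_eq_numGt_succ m hij
      first := fun j hj => numGt_first m hj
      last := fun j hj => numGe_last m hj
      eq := fun j => rfl }
  -- The comparison needs a threshold k suited to the size of I; it is the distinct exponent whose
  -- interval [p_j, q_j] contains that size.
  have hle : ∀ I : Finset (Fin n), ∑ i ∈ I, m i ≤ topSum m I.card := by
    intro I
    obtain ⟨j, hp, hq⟩ := hadapted.exists_index (d := I.card)
      ((Finset.card_le_univ I).trans (by simp))
    exact sum_le_topSum hanti hp hq
  obtain ⟨hinv, hlim⟩ := opTendsto_rho hν hγ.2
    (fun d => finTendsto_smul_lamCha ha hb hfac hle hb' d)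
  refine ⟨rho ν (coordOp e E (maxWeight m)), rho_coordOp_maxWeight_ne_zero hb' E m hinv, hlim, P,
    fun j => tendsto_graph hanti ha hb hfac _ hb' rfl, hadapted.isHinge,
    hadapted.exists_canonical, fun L hL => rho_congr (bigRho_congr fun d hd => ?_)⟩
  obtain ⟨j, hp, hq, hLd⟩ := hadapted.canonical_eq hL hd
  rw [hLd]
  exact coordOp_congr e E fun I hI =>
    (lamWeight_eq_maxWeight hanti (by rw [hI]; exact hp) (by rw [hI]; exact hq)).symm
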